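/- Let $n\ge 3$. A \emph{density} on $\mathbb{R}^n$ is a positive lower semicontinuous function $f:\mathbb{R}^n\to(0,\infty)$. For a set $E\subseteq\mathbb{R}^n$ of locally finite perimeter put $$|E|_f=\int_E f\,dx,\qquad P_f(E)=\int_{\partial E} f\,d\mathcal{H}^{n-1},$$ where $\partial E$ is the essential boundary of $E$ (the points at which $E$ has neither Lebesgue density $0$ nor Lebesgue density $1$). For $V>0$ let $$\mathfrak{I}_f(V)=\inf\{P_f(E): E \text{ of locally finite perimeter},\ |E|_f=V\},$$ and call $E$ an \emph{isoperimetric set} if $P_f(E)=\mathfrak{I}_f(|E|_f)$. Then there exists a density $f$ on $\mathbb{R}^n$ such that - $f$ is non-decreasing, that is, for every unit vector $\theta$ the function $t\mapsto f(t\theta)$ is non-decreasing on $[0,\infty)$; - $f$ is diverging, that is, $f(x)\to\infty$ as $|x|\to\infty$; - $f$ is not radial, that is, $f(x)$ is not a function of $|x|$ alone; - $\mathfrak{I}_f(1)=0$; - there is no isoperimetric set $E$ with $|E|_f=1$. -/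

import Mathlib

open Set Filter Topology MeasureTheory
open scoped ENNReal

namespace IsoDensity

/-- A density on `ℝⁿ`: a positive lower semicontinuous function. -/
structure IsDensity {n : ℕ} (f : EuclideanSpace ℝ (Fin n) → ℝ) : Prop where
  pos : ∀ x, 0 < f x
  lowerSemicontinuous : LowerSemicontinuous f

/-- `f` is non-decreasing along every ray issuing from the origin. -/
def IsRadiallyNondecreasing {n : ℕ} (f : EuclideanSpace ℝ (Fin n) → ℝ) : Prop :=
  ∀ θ : EuclideanSpace ℝ (Fin n), ‖θ‖ = 1 → MonotoneOn (fun t : ℝ => f (t • θ)) (Ici 0)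

/-- `f x` depends only on `‖x‖`. -/
def IsRadial {n : ℕ} (f : EuclideanSpace ℝ (Fin n) → ℝ) : Prop :=
  ∀ x y : EuclideanSpace ℝ (Fin n), ‖x‖ = ‖y‖ → f x = f y

/-- `f x → ∞` as `‖x‖ → ∞`. -/
def IsDiverging {n : ℕ} (f : EuclideanSpace ℝ (Fin n) → ℝ) : Prop :=
  Tendsto f (cocompact (EuclideanSpace ℝ (Fin n))) atTop

/-- The divergence of a vector field on `ℝⁿ`. -/
noncomputable def divergence {n : ℕ}
    (φ : EuclideanSpace ℝ (Fin n) → EuclideanSpace ℝ (Fin n))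
    (x : EuclideanSpace ℝ (Fin n)) : ℝ :=
  ∑ i : Fin n, fderiv ℝ φ x (EuclideanSpace.single i 1) i

/-- `E` is a (Lebesgue measurable) set of locally finite perimeter: over every compact set `K`,
the variation of the indicator function of `E`, i.e. the supremum of `∫_E div φ` over the `C¹`
fields `φ` supported in `K` with `|φ| ≤ 1`, is finite. -/
structure HasLocallyFinitePerimeter {n : ℕ} (E : Set (EuclideanSpace ℝ (Fin n))) : Prop where
  nullMeasurableSet : NullMeasurableSet E volume
  variation_bounded : ∀ K : Set (EuclideanSpace ℝ (Fin n)), IsCompact K →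
    ∃ C : ℝ, ∀ φ : EuclideanSpace ℝ (Fin n) → EuclideanSpace ℝ (Fin n),
      ContDiff ℝ 1 φ → tsupport φ ⊆ K → (∀ x, ‖φ x‖ ≤ 1) →
        ∫ x in E, divergence φ x ≤ C

/-- `E` has Lebesgue density `θ` at the point `x`. -/
def HasDensityAt {n : ℕ} (E : Set (EuclideanSpace ℝ (Fin n))) (θ : ℝ≥0∞)
    (x : EuclideanSpace ℝ (Fin n)) : Prop :=
  Tendsto (fun r : ℝ => volume (E ∩ Metric.closedBall x r) / volume (Metric.closedBall x r))
    (𝓝[>] 0) (𝓝 θ)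

/-- The essential boundary of `E`: the points at which `E` has neither density `0` nor
density `1`. -/
def essentialBoundary {n : ℕ} (E : Set (EuclideanSpace ℝ (Fin n))) :
    Set (EuclideanSpace ℝ (Fin n)) :=
  {x | ¬ HasDensityAt E 0 x ∧ ¬ HasDensityAt E 1 x}

/-- The weighted volume `|E|_f = ∫_E f dx`. -/
noncomputable def weightedVolume {n : ℕ} (f : EuclideanSpace ℝ (Fin n) → ℝ)
    (E : Set (EuclideanSpace ℝ (Fin n))) : ℝ≥0∞ :=
  ∫⁻ x in E, ENNReal.ofReal (f x)

/-- The weighted perimeter `P_f(E) = ∫_{∂E} f dℋⁿ⁻¹`, where `∂E` is the essential boundary and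
`ℋⁿ⁻¹` is the Euclidean (normalized) Hausdorff measure. -/
noncomputable def weightedPerimeter {n : ℕ} (f : EuclideanSpace ℝ (Fin n) → ℝ)
    (E : Set (EuclideanSpace ℝ (Fin n))) : ℝ≥0∞ :=
  ∫⁻ x in essentialBoundary E, ENNReal.ofReal (f x) ∂(Measure.euclideanHausdorffMeasure (n - 1))

/-- The isoperimetric profile: the infimum of `P_f(E)` over the sets `E` of locally finite
perimeter with `|E|_f = V`. -/
noncomputable def isoperimetricProfile {n : ℕ} (f : EuclideanSpace ℝ (Fin n) → ℝ)
    (V : ℝ≥0∞) : ℝ≥0∞ :=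
  sInf {p | ∃ E : Set (EuclideanSpace ℝ (Fin n)),
    HasLocallyFinitePerimeter E ∧ weightedVolume f E = V ∧ weightedPerimeter f E = p}

/-- `E` is an isoperimetric set for the density `f`. -/
def IsIsoperimetricSet {n : ℕ} (f : EuclideanSpace ℝ (Fin n) → ℝ)
    (E : Set (EuclideanSpace ℝ (Fin n))) : Prop :=
  HasLocallyFinitePerimeter E ∧
    weightedPerimeter f E = isoperimetricProfile f (weightedVolume f E)

end IsoDensity

/-! The density is built from `1 + ‖x‖` by successive raisings. Write `n = l + 2` and `a = 2 ^ k`.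
Stage `k` adds a constant `c` on the open cone of small slope `ρ` around the first axis, above
height `a`. The cone is open and stable under dilations by factors at least one, so lower
semicontinuity and radial monotonicity survive. The constant `c` gives the frustum between heights
`a` and `2a` weighted volume one. Its bottom and lateral faces lie outside the open cone, so they
carry the old, locally bounded density; for fixed `a` their area is `O(ρ ^ l)`, negligible for small
`ρ` because `l ≥ 1`, that is `n ≥ 3`. Only the top face sees `c`; its area is `O(volume / a)`, so it
costs `O(1 / a)` whatever `ρ` is (`Admissible.exists_raise`). Stage `k` leaves the half-space `x_0 ≤
2 ^ k` untouched, so the stages stabilise at each point (`exists_density_limit`) and the profile at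
`1` vanishes.

A minimiser would have zero weighted perimeter, hence an `ℋⁿ⁻¹`-null essential boundary. Such a set
is null or conull (`ae_mem_or_ae_notMem_of_essentialBoundary_null`), so its weighted volume is `0`
or `∞`. For this, almost every axis-parallel line misses the essential boundary, so each of its
points has density `0` or `1`, and both sets of points are `F_σ` in the line. If both occur, Baire's
theorem produces a one-sided switch between them (`eq_empty_or_eq_univ_of_no_switch`), while a
density estimate excludes switches on almost every line (`volume_image_snd_lowDensity_eq_zero`). The
set is thus translation invariant up to null sets, and ergodicity of translations concludes. -/

namespace IsoDensity

/-! ### Splitting off one coordinate of Euclidean space. -/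

/-- Insert `p.1` as the `i`-th coordinate of `p.2`. -/
noncomputable def insertCoord {m : ℕ} (i : Fin (m + 1)) (p : ℝ × EuclideanSpace ℝ (Fin m)) :
    EuclideanSpace ℝ (Fin (m + 1)) :=
  WithLp.toLp 2 (i.insertNth p.1 p.2.ofLp)

/-- Forget the `i`-th coordinate. -/
noncomputable def removeCoord {m : ℕ} (i : Fin (m + 1)) (x : EuclideanSpace ℝ (Fin (m + 1))) :
    EuclideanSpace ℝ (Fin m) :=
  WithLp.toLp 2 (i.removeNth x.ofLp)

section Coord

variable {m : ℕ} (i : Fin (m + 1))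

@[simp] theorem insertCoord_same (p : ℝ × EuclideanSpace ℝ (Fin m)) : insertCoord i p i = p.1 := by
  simp [insertCoord]

@[simp] theorem insertCoord_succAbove (p : ℝ × EuclideanSpace ℝ (Fin m)) (j : Fin m) :
    insertCoord i p (i.succAbove j) = p.2 j := by
  simp [insertCoord]

@[simp] theorem removeCoord_apply (x : EuclideanSpace ℝ (Fin (m + 1))) (j : Fin m) :
    removeCoord i x j = x (i.succAbove j) := rfl

theorem ext_coord {x y : EuclideanSpace ℝ (Fin (m + 1))} (h : x i = y i)
    (h' : ∀ j, x (i.succAbove j) = y (i.succAbove j)) : x = y := by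
  ext k
  rcases Fin.eq_self_or_eq_succAbove i k with rfl | ⟨j, rfl⟩
  exacts [h, h' j]

@[simp] theorem removeCoord_insertCoord (p : ℝ × EuclideanSpace ℝ (Fin m)) :
    removeCoord i (insertCoord i p) = p.2 := by
  ext j; simp

@[simp] theorem insertCoord_removeCoord (x : EuclideanSpace ℝ (Fin (m + 1))) :
    insertCoord i (x i, removeCoord i x) = x :=
  ext_coord i (by simp) (by simp)

theorem norm_sq_coord (x : EuclideanSpace ℝ (Fin (m + 1))) :
    ‖x‖ ^ 2 = x i ^ 2 + ‖removeCoord i x‖ ^ 2 := by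
  simp [EuclideanSpace.norm_sq_eq, Fin.sum_univ_succAbove _ i]

theorem dist_insertCoord_sq (p q : ℝ × EuclideanSpace ℝ (Fin m)) :
    dist (insertCoord i p) (insertCoord i q) ^ 2 = (p.1 - q.1) ^ 2 + dist p.2 q.2 ^ 2 := by
  rw [dist_eq_norm, norm_sq_coord i, dist_eq_norm]
  congr 2
  · simp
  · congr 1
    ext j
    simp

theorem dist_insertCoord_le (p q : ℝ × EuclideanSpace ℝ (Fin m)) :
    dist (insertCoord i p) (insertCoord i q) ≤ |p.1 - q.1| + dist p.2 q.2 := by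
  refine (sq_le_sq₀ dist_nonneg (by positivity)).1 ?_
  rw [dist_insertCoord_sq, add_sq, sq_abs]
  have : 0 ≤ 2 * |p.1 - q.1| * dist p.2 q.2 := by positivity
  linarith

theorem insertCoord_add_single (p : ℝ × EuclideanSpace ℝ (Fin m)) (t : ℝ) :
    insertCoord i p + EuclideanSpace.single i t = insertCoord i (p.1 + t, p.2) :=
  ext_coord i (by simp) (by simp [Fin.succAbove_ne])

theorem lipschitzWith_removeCoord : LipschitzWith 1 (removeCoord i) := by
  refine LipschitzWith.of_dist_le_mul fun x y => ?_
  rw [NNReal.coe_one, one_mul]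
  refine (sq_le_sq₀ dist_nonneg dist_nonneg).1 ?_
  rw [← insertCoord_removeCoord i x, ← insertCoord_removeCoord i y, dist_insertCoord_sq]
  simp only [removeCoord_insertCoord]
  exact le_add_of_nonneg_left (sq_nonneg _)

theorem measurePreserving_insertCoord :
    MeasurePreserving (insertCoord (m := m) i) (volume.prod volume) volume := by
  have h1 := (volume_preserving_piFinSuccAbove (fun _ : Fin (m + 1) => ℝ) i).symm
  have h2 := PiLp.volume_preserving_toLp (Fin (m + 1))
  have h3 : MeasurePreserving (Prod.map id WithLp.ofLp : ℝ × EuclideanSpace ℝ (Fin m) → _)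
      (volume.prod volume) (volume.prod volume) :=
    (MeasurePreserving.id volume).prod (PiLp.volume_preserving_ofLp (Fin m))
  exact h2.comp (h1.comp h3)

theorem continuous_insertCoord : Continuous (insertCoord (m := m) i) := by
  unfold insertCoord
  refine (PiLp.continuous_toLp 2 _).comp ?_
  fun_prop

end Coord

/-! ### Partitions of the line into two `F_σ` sets. -/

/-- Between a frontier point and an interior point of `A ⊆ ℝ` there is a frontier point with a
one-sided neighbourhood contained in `A`. -/
theorem exists_oneSided_of_frontier {A : Set ℝ} {p q : ℝ} {I F : Set ℝ} (hI : I.OrdConnected)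
    (hpI : p ∈ I) (hqI : q ∈ I) (hp : p ∈ frontier A) (hq : q ∈ interior A)
    (hF : I ∩ frontier A ⊆ F) :
    ∃ x ∈ F, ∃ δ > 0, Ioo x (x + δ) ⊆ A ∨ Ioo (x - δ) x ⊆ A := by
  have hpn : p ∉ interior A := fun h => hp.2 h
  rcases lt_trichotomy p q with h | h | h
  · have hS : IsCompact (Icc p q \ interior A) := isCompact_Icc.diff isOpen_interior
    -- The last point before `q` outside the interior: everything between it and `q` belongs to `A`.
    obtain ⟨x, hxS, hx⟩ := hS.exists_isGreatest ⟨p, ⟨le_rfl, h.le⟩, hpn⟩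
    have hxq : x < q := lt_of_le_of_ne hxS.1.2 fun e => hxS.2 (e ▸ hq)
    have hsub : Ioo x q ⊆ interior A := fun y hy => by
      by_contra hy'
      exact absurd (hx ⟨⟨hxS.1.1.trans hy.1.le, hy.2.le⟩, hy'⟩) (not_le.2 hy.1)
    have hxc : x ∈ closure A := by
      refine closure_mono (hsub.trans interior_subset) ?_
      rw [closure_Ioo hxq.ne]; exact ⟨le_rfl, hxq.le⟩
    refine ⟨x, hF ⟨hI.out hpI hqI hxS.1, hxc, hxS.2⟩, q - x, sub_pos.2 hxq, Or.inl ?_⟩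
    rw [add_sub_cancel]; exact hsub.trans interior_subset
  · exact absurd (h ▸ hq) hpn
  · have hS : IsCompact (Icc q p \ interior A) := isCompact_Icc.diff isOpen_interior
    obtain ⟨x, hxS, hx⟩ := hS.exists_isLeast ⟨p, ⟨h.le, le_rfl⟩, hpn⟩
    have hxq : q < x := lt_of_le_of_ne hxS.1.1 fun e => hxS.2 (e ▸ hq)
    have hsub : Ioo q x ⊆ interior A := fun y hy => by
      by_contra hy'
      exact absurd (hx ⟨⟨hy.1.le, hy.2.le.trans hxS.1.2⟩, hy'⟩) (not_le.2 hy.2)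
    have hxc : x ∈ closure A := by
      refine closure_mono (hsub.trans interior_subset) ?_
      rw [closure_Ioo hxq.ne]; exact ⟨hxq.le, le_rfl⟩
    refine ⟨x, hF ⟨hI.out hqI hpI hxS.1, hxc, hxS.2⟩, x - q, sub_pos.2 hxq, Or.inr ?_⟩
    rw [sub_sub_cancel]; exact hsub.trans interior_subset

/-- Near `p` all frontier points belong to `A`, so a nearby point of `Aᶜ` is interior to `Aᶜ`, and
the preceding lemma applies to `Aᶜ`. -/
theorem exists_oneSided_compl {A F : Set ℝ} {p : ℝ} {I : Set ℝ} (hI : I.OrdConnected)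
    (hIo : IsOpen I) (hp : p ∈ frontier A) (hpI : p ∈ I) (hF : I ∩ frontier A ⊆ F)
    (hFA : F ⊆ A) :
    ∃ x ∈ F, ∃ δ > 0, Ioo x (x + δ) ⊆ Aᶜ ∨ Ioo (x - δ) x ⊆ Aᶜ := by
  have hpc : p ∈ frontier Aᶜ := by rwa [frontier_compl]
  obtain ⟨q, hqI, hqA⟩ := mem_closure_iff.1 hpc.1 I hIo hpI
  have hq : q ∈ interior Aᶜ := by
    by_contra h
    have : q ∈ frontier A := by rw [← frontier_compl]; exact ⟨subset_closure hqA, h⟩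
    exact hqA (hFA (hF ⟨hqI, this⟩))
  exact exists_oneSided_of_frontier hI hpI hqI hpc hq (by rwa [frontier_compl])

/-- A decomposition of the line into two `F_σ` sets without one-sided switches is trivial. -/
theorem eq_empty_or_eq_univ_of_no_switch {a b : ℕ → Set ℝ} {A : Set ℝ}
    (ha : ∀ k, IsClosed (a k)) (hb : ∀ k, IsClosed (b k))
    (hA : ⋃ k, a k = A) (hB : ⋃ k, b k = Aᶜ)
    (hna : ∀ k, ∀ x ∈ a k, ∀ δ > 0, ¬ Ioo x (x + δ) ⊆ Aᶜ ∧ ¬ Ioo (x - δ) x ⊆ Aᶜ)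
    (hnb : ∀ k, ∀ x ∈ b k, ∀ δ > 0, ¬ Ioo x (x + δ) ⊆ A ∧ ¬ Ioo (x - δ) x ⊆ A) :
    A = ∅ ∨ A = univ := by
  rw [← frontier_eq_empty_iff]
  by_contra hne
  have hFc : IsClosed (frontier A) := isClosed_frontier
  have : Nonempty (frontier A) := (nonempty_iff_ne_empty.2 hne).to_subtype
  have : CompleteSpace (frontier A) := hFc.completeSpace_coe
  -- Baire's theorem on the closed set `frontier A`: one of the countably many closed traces
  -- contains a relatively open portion of it. There all frontier points are on the same side, which
  -- forces a forbidden switch.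
  let c : ℕ ⊕ ℕ → Set (frontier A) := Sum.elim (fun k => (↑) ⁻¹' a k) (fun k => (↑) ⁻¹' b k)
  have hc : ∀ s, IsClosed (c s) := by
    rintro (k | k)
    exacts [(ha k).preimage continuous_subtype_val, (hb k).preimage continuous_subtype_val]
  have hU : ⋃ s, c s = univ := by
    rw [iUnion_sum]
    simp only [c, Sum.elim_inl, Sum.elim_inr, ← preimage_iUnion, hA, hB, ← preimage_union,
      union_compl_self, preimage_univ]
  obtain ⟨s, ⟨x, hx⟩⟩ := nonempty_interior_of_iUnion_of_closed hc hU
  obtain ⟨V, hVo, hV⟩ := isOpen_induced_iff.1 (isOpen_interior (s := c s))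
  have hxV : (x : ℝ) ∈ V := by
    have : x ∈ (Subtype.val ⁻¹' V : Set (frontier A)) := by rw [hV]; exact hx
    exact this
  obtain ⟨ε, hε, hεV⟩ := Metric.isOpen_iff.1 hVo _ hxV
  have hI : (Metric.ball (x : ℝ) ε).OrdConnected := by
    rw [Real.ball_eq_Ioo]; exact ordConnected_Ioo
  have key : ∀ y ∈ Metric.ball (x : ℝ) ε, ∀ hy : y ∈ frontier A, (⟨y, hy⟩ : frontier A) ∈ c s := by
    intro y hy hyF
    have : (⟨y, hyF⟩ : frontier A) ∈ (Subtype.val ⁻¹' V : Set (frontier A)) := hεV hy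
    rw [hV] at this
    exact interior_subset this
  rcases s with k | k
  · obtain ⟨y, hy, δ, hδ, h⟩ := exists_oneSided_compl (F := a k) hI Metric.isOpen_ball x.2
      (Metric.mem_ball_self hε) (fun y hy => key y hy.1 hy.2) (hA ▸ subset_iUnion a k)
    exact h.elim (hna k y hy δ hδ).1 (hna k y hy δ hδ).2
  · obtain ⟨y, hy, δ, hδ, h⟩ := exists_oneSided_compl (A := Aᶜ) (F := b k) hI Metric.isOpen_ball
      (by rw [frontier_compl]; exact x.2)
      (Metric.mem_ball_self hε) (fun y hy => key y hy.1 (by rw [← frontier_compl]; exact hy.2))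
      (hB ▸ subset_iUnion b k)
    rw [compl_compl] at h
    exact h.elim (hnb k y hy δ hδ).1 (hnb k y hy δ hδ).2

/-! ### The density estimate excluding switches. -/

/-- The points of low density of `E` (at all scales below `δ`) at which a segment of length `δ`
contained in `E` starts, in a fixed direction, project onto a null set. -/
theorem volume_image_snd_lowDensity_eq_zero {m : ℕ}
    {J : ℝ × EuclideanSpace ℝ (Fin m) → EuclideanSpace ℝ (Fin (m + 1))}
    (hJ : MeasurePreserving J (volume.prod volume) volume)
    (hd : ∀ p q, dist (J p) (J q) ≤ |p.1 - q.1| + dist p.2 q.2)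
    {E A : Set (EuclideanSpace ℝ (Fin (m + 1)))} {δ : ℝ} (hδ : 0 < δ) {η : ℝ≥0∞}
    (hη : η * volume (Metric.closedBall (0 : EuclideanSpace ℝ (Fin (m + 1))) 4) <
      2⁻¹ * volume (Metric.closedBall (0 : EuclideanSpace ℝ (Fin m)) 1))
    (hA : ∀ x ∈ A, ∀ r, 0 < r → r < δ →
      volume (E ∩ Metric.closedBall x r) ≤ η * volume (Metric.closedBall x r)) :
    volume (Prod.snd '' {p | J p ∈ A ∧ ∀ s ∈ Ioo 0 δ, J (p.1 + s, p.2) ∈ E}) = 0 := by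
  set P := {p | J p ∈ A ∧ ∀ s ∈ Ioo 0 δ, J (p.1 + s, p.2) ∈ E} with hP
  -- Starting heights within one slab differ by at most `δ / 2`, so all the segments starting there
  -- still run through a common layer just above the highest start.
  let Q : ℤ → Set (ℝ × EuclideanSpace ℝ (Fin m)) := fun q =>
    {p ∈ P | q * (δ / 2) ≤ p.1 ∧ p.1 < (q + 1) * (δ / 2)}
  have hcover : Prod.snd '' P ⊆ ⋃ q, Prod.snd '' Q q := by
    rintro _ ⟨p, hp, rfl⟩
    refine mem_iUnion.2 ⟨⌊p.1 / (δ / 2)⌋, p, ⟨hp, ?_, ?_⟩, rfl⟩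
    · rw [← le_div_iff₀ (by positivity)]; exact Int.floor_le _
    · rw [← div_lt_iff₀ (by positivity)]; exact Int.lt_floor_add_one _
  refine measure_mono_null hcover (measure_iUnion_null fun q => ?_)
  set D := Prod.snd '' Q q with hD
  by_contra h0
  have : (ae (volume.restrict D)).NeBot := by
    rw [ae_neBot]; exact fun h => h0 (Measure.restrict_eq_zero.1 h)
  -- A density point of the projection `D`; neither this theorem nor the product formula below needs
  -- `D` to be measurable.
  obtain ⟨z, hz⟩ := (Besicovitch.ae_tendsto_measure_inter_div volume D).exists
  have h1 := hz.eventually (lt_mem_nhds (show (2⁻¹ : ℝ≥0∞) < 1 by simp))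
  have h2 : ∀ᶠ r : ℝ in 𝓝[>] 0, r < δ / 4 :=
    mem_nhdsWithin_of_mem_nhds (Iio_mem_nhds (by positivity))
  obtain ⟨r, ⟨hr1, hr2⟩, hr0 : 0 < r⟩ := ((h1.and h2).and self_mem_nhdsWithin).exists
  have hBpos : volume (Metric.closedBall z r) ≠ 0 :=
    (Metric.measure_closedBall_pos volume z hr0).ne'
  have hBtop : volume (Metric.closedBall z r) ≠ ∞ := measure_closedBall_lt_top.ne
  rw [ENNReal.lt_div_iff_mul_lt (Or.inl hBpos) (Or.inl hBtop)] at hr1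
  obtain ⟨y0, hy0D, hy0z⟩ : (D ∩ Metric.closedBall z r).Nonempty :=
    nonempty_of_measure_ne_zero (pos_of_gt hr1).ne'
  let H : Set ℝ := {t | ∃ y ∈ Metric.closedBall z r, (t, y) ∈ Q q}
  have hHne : H.Nonempty := by
    obtain ⟨⟨t, y⟩, hty, rfl⟩ := hy0D
    exact ⟨t, y, hy0z, hty⟩
  have hHb : ∀ t ∈ H, t ≤ (q + 1) * (δ / 2) := fun t ⟨y, _, hy⟩ => hy.2.2.le
  -- The supremum of the heights need not be attained; a start within `r` of it serves as centre.
  -- The layer of thickness `r` over `D ∩ closedBall z r` then lies in `E` and within `2r + 2r` of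
  -- that centre, too much volume for a low-density point.
  obtain ⟨t₁, ⟨y₁, hy₁z, hy₁⟩, ht₁⟩ := exists_lt_of_lt_csSup hHne (sub_lt_self (sSup H) hr0)
  have ht₁' : t₁ ≤ sSup H := le_csSup ⟨_, hHb⟩ ⟨y₁, hy₁z, hy₁⟩
  have hsub : Ioo (sSup H) (sSup H + r) ×ˢ (D ∩ Metric.closedBall z r) ⊆
      J ⁻¹' (E ∩ Metric.closedBall (J (t₁, y₁)) (4 * r)) := by
    rintro ⟨s, y⟩ ⟨⟨hs1, hs2⟩, ⟨⟨t, y⟩, hty, rfl⟩, hyz⟩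
    dsimp only at hs1 hs2 hyz
    have htH : t ≤ sSup H := le_csSup ⟨_, hHb⟩ ⟨y, hyz, hty⟩
    have hHt : sSup H ≤ (q + 1) * (δ / 2) := csSup_le hHne hHb
    have hqt : q * (δ / 2) ≤ t := hty.2.1
    refine ⟨?_, ?_⟩
    · have := hty.1.2 (s - t) ⟨by linarith, by linarith⟩
      simpa using this
    · refine (hd _ _).trans ?_
      have h1 : |s - t₁| ≤ 2 * r := by rw [abs_le]; constructor <;> linarith
      have h2 : dist y y₁ ≤ r + r :=
        (dist_triangle_right y y₁ z).trans (add_le_add hyz hy₁z)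
      dsimp only
      linarith
  have hle : ENNReal.ofReal r * volume (D ∩ Metric.closedBall z r) ≤
      η * volume (Metric.closedBall (J (t₁, y₁)) (4 * r)) := by
    calc _ = (volume.prod volume) (Ioo (sSup H) (sSup H + r) ×ˢ (D ∩ Metric.closedBall z r)) := by
          rw [Measure.prod_prod, Real.volume_Ioo, add_sub_cancel_left]
      _ ≤ _ := measure_mono hsub
      _ ≤ volume (E ∩ Metric.closedBall (J (t₁, y₁)) (4 * r)) := hJ.measure_preimage_le _
      _ ≤ _ := hA _ hy₁.1.1 _ (by positivity) (by linarith)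
  have hc : ENNReal.ofReal (r ^ (m + 1)) ≠ 0 := by simp [hr0]
  rw [mul_comm 4 r, Measure.addHaar_closedBall_mul_of_pos _ _ hr0, finrank_euclideanSpace,
    Fintype.card_fin, mul_left_comm] at hle
  rw [Measure.addHaar_closedBall' _ _ hr0.le, finrank_euclideanSpace, Fintype.card_fin] at hr1
  have hlt : ENNReal.ofReal (r ^ (m + 1)) *
        (2⁻¹ * volume (Metric.closedBall (0 : EuclideanSpace ℝ (Fin m)) 1)) ≤
      ENNReal.ofReal r * volume (D ∩ Metric.closedBall z r) := by
    refine le_trans (le_of_eq ?_) (mul_le_mul_right hr1.le _)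
    rw [pow_succ', ENNReal.ofReal_mul hr0.le]
    ring
  have := (ENNReal.mul_le_mul_iff_right hc ENNReal.ofReal_ne_top).1 (hlt.trans hle)
  exact absurd hη (not_lt.2 this)

theorem euclideanHausdorffMeasure_image_le {X Y : Type*} [EMetricSpace X] [MeasurableSpace X]
    [BorelSpace X] [EMetricSpace Y] [MeasurableSpace Y] [BorelSpace Y] {K : NNReal} {f : X → Y}
    {s : Set X} (hf : LipschitzOnWith K f s) (d : ℕ) :
    Measure.euclideanHausdorffMeasure d (f '' s) ≤
      (K : ℝ≥0∞) ^ d * Measure.euclideanHausdorffMeasure d s := by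
  have := hf.hausdorffMeasure_image_le (Nat.cast_nonneg d)
  simp only [Measure.euclideanHausdorffMeasure_def, Measure.smul_apply, ENNReal.smul_def,
    smul_eq_mul]
  rw [mul_left_comm]
  rw [ENNReal.rpow_natCast] at this
  gcongr

/-! ### Points of Lebesgue density zero and one. -/

section Density

variable {n : ℕ} {E : Set (EuclideanSpace ℝ (Fin n))} {x : EuclideanSpace ℝ (Fin n)}

/-- The points at which `E` has relative volume at most `η` in all balls of radius less than
`1 / (k + 1)`. -/
def lowDensitySet (E : Set (EuclideanSpace ℝ (Fin n))) (η : ℝ≥0∞) (k : ℕ) :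
    Set (EuclideanSpace ℝ (Fin n)) :=
  {x | ∀ r : ℝ, 0 < r → r < 1 / (k + 1) →
    volume (E ∩ Metric.closedBall x r) ≤ η * volume (Metric.closedBall x r)}

theorem lowDensitySet_mono (η : ℝ≥0∞) : Monotone (lowDensitySet E η) :=
  fun _ _ hkl _ hx r hr hr' => hx r hr (hr'.trans_le (Nat.one_div_le_one_div hkl))

/-- The strict bound on the radius leaves room to enlarge it: a ball around a limit point sits in
slightly larger balls around the approximating points, and the volume of balls is continuous in the
radius. -/
theorem isClosed_lowDensitySet {η : ℝ≥0∞} (hη : η ≠ ∞) (k : ℕ) :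
    IsClosed (lowDensitySet E η k) := by
  refine isClosed_of_closure_subset fun x hx r hr hrk => ?_
  have hcont : Tendsto (fun s : ℝ => η * volume (Metric.closedBall x s)) (𝓝[>] r)
      (𝓝 (η * volume (Metric.closedBall x r))) := by
    refine ENNReal.Tendsto.const_mul ?_ (Or.inr hη)
    rw [Measure.addHaar_closedBall' _ _ hr.le]
    have : Tendsto (fun s : ℝ => ENNReal.ofReal
        (s ^ Module.finrank ℝ (EuclideanSpace ℝ (Fin n))) *
          volume (Metric.closedBall (0 : EuclideanSpace ℝ (Fin n)) 1)) (𝓝[>] r)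
        (𝓝 (ENNReal.ofReal (r ^ Module.finrank ℝ (EuclideanSpace ℝ (Fin n))) *
          volume (Metric.closedBall (0 : EuclideanSpace ℝ (Fin n)) 1))) := by
      refine ENNReal.Tendsto.mul_const ?_ (Or.inr measure_closedBall_lt_top.ne)
      exact (ENNReal.continuous_ofReal.comp (continuous_pow _)).continuousWithinAt.tendsto
    refine this.congr' ?_
    filter_upwards [self_mem_nhdsWithin] with s hs
    rw [Measure.addHaar_closedBall' _ _ (hr.le.trans (le_of_lt hs))]
  refine ge_of_tendsto hcont ?_
  filter_upwards [self_mem_nhdsWithin, mem_nhdsWithin_of_mem_nhds (Iio_mem_nhds hrk)] with s hs hsk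
  obtain ⟨y, hy, hxy⟩ := Metric.mem_closure_iff.1 hx (s - r) (sub_pos.2 hs)
  calc volume (E ∩ Metric.closedBall x r) ≤ volume (E ∩ Metric.closedBall y s) := by
        gcongr
        exact Metric.closedBall_subset_closedBall' (by linarith)
    _ ≤ η * volume (Metric.closedBall y s) := hy s (hr.trans hs) hsk
    _ = _ := by rw [Measure.addHaar_closedBall_center, Measure.addHaar_closedBall_center _ x]

theorem HasDensityAt.exists_mem_lowDensitySet (h : HasDensityAt E 0 x) {η : ℝ≥0∞} (hη : 0 < η) :
    ∃ k, x ∈ lowDensitySet E η k := by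
  have h1 := h.eventually (gt_mem_nhds hη)
  obtain ⟨ε, hε, hsub⟩ := mem_nhdsGT_iff_exists_Ioo_subset.1 h1
  obtain ⟨k, hk⟩ := exists_nat_one_div_lt (mem_Ioi.1 hε)
  refine ⟨k, fun r hr hrk => ?_⟩
  have : volume (E ∩ Metric.closedBall x r) / volume (Metric.closedBall x r) < η :=
    hsub ⟨hr, hrk.trans hk⟩
  rw [ENNReal.div_lt_iff (Or.inl (Metric.measure_closedBall_pos volume x hr).ne')
    (Or.inl measure_closedBall_lt_top.ne)] at this
  exact this.le

theorem not_hasDensityAt_one_of_mem {η : ℝ≥0∞} (hη : η < 1) {k : ℕ}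
    (hx : x ∈ lowDensitySet E η k) : ¬ HasDensityAt E 1 x := by
  intro h
  have h2 : ∀ᶠ r : ℝ in 𝓝[>] 0, r < 1 / (k + 1) :=
    mem_nhdsWithin_of_mem_nhds (Iio_mem_nhds (by positivity))
  obtain ⟨r, ⟨h1, h2⟩, hr : 0 < r⟩ :=
    (((h.eventually (lt_mem_nhds hη)).and h2).and self_mem_nhdsWithin).exists
  rw [ENNReal.lt_div_iff_mul_lt (Or.inl (Metric.measure_closedBall_pos volume x hr).ne')
    (Or.inl measure_closedBall_lt_top.ne)] at h1
  exact absurd (hx r hr h2) (not_le.2 h1)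

theorem HasDensityAt.compl (hE : NullMeasurableSet E) {θ : ℝ≥0∞} (h : HasDensityAt E θ x) :
    HasDensityAt Eᶜ (1 - θ) x := by
  have := ENNReal.Tendsto.sub (tendsto_const_nhds (x := (1 : ℝ≥0∞))) h (Or.inl ENNReal.one_ne_top)
  refine this.congr' ?_
  filter_upwards [self_mem_nhdsWithin] with r hr
  have hpos := (Metric.measure_closedBall_pos volume x hr).ne'
  have htop : volume (Metric.closedBall x r) ≠ ∞ := measure_closedBall_lt_top.ne
  have hfin : volume (E ∩ Metric.closedBall x r) ≠ ∞ :=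
    (measure_mono inter_subset_right).trans_lt measure_closedBall_lt_top |>.ne
  have : volume (Eᶜ ∩ Metric.closedBall x r) =
      volume (Metric.closedBall x r) - volume (E ∩ Metric.closedBall x r) := by
    rw [← measure_sdiff inter_subset_right
      (hE.inter measurableSet_closedBall.nullMeasurableSet) hfin]
    congr 1
    ext y
    simp only [mem_inter_iff, mem_compl_iff, Set.mem_sdiff]
    tauto
  rw [this, ENNReal.sub_div fun _ _ => hpos, ENNReal.div_self hpos htop]

theorem hasDensityAt_compl_zero_iff (hE : NullMeasurableSet E) :
    HasDensityAt Eᶜ 0 x ↔ HasDensityAt E 1 x :=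
  ⟨fun h => by simpa using h.compl hE.compl, fun h => by simpa using h.compl hE⟩

theorem HasDensityAt.not_one_of_zero (h : HasDensityAt E 0 x) : ¬ HasDensityAt E 1 x :=
  fun h' => zero_ne_one (tendsto_nhds_unique h h')

theorem ae_mem_imp_hasDensityAt_one (E : Set (EuclideanSpace ℝ (Fin n))) :
    ∀ᵐ x, x ∈ E → HasDensityAt E 1 x := by
  have h := Besicovitch.ae_tendsto_measure_inter_div volume E
  rw [ae_iff] at h ⊢
  refine le_antisymm ((le_trans (measure_mono ?_) (Measure.le_restrict_apply E _)).trans h.le)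
    bot_le
  intro x hx
  simp only [Classical.not_imp, mem_ofPred_eq] at hx
  exact ⟨hx.2, hx.1⟩

theorem ae_mem_iff_hasDensityAt_one (hE : NullMeasurableSet E) :
    ∀ᵐ x, x ∈ E ↔ HasDensityAt E 1 x := by
  filter_upwards [ae_mem_imp_hasDensityAt_one E, ae_mem_imp_hasDensityAt_one Eᶜ] with x h1 h2
  refine ⟨h1, fun h => ?_⟩
  by_contra hx
  rw [← hasDensityAt_compl_zero_iff hE] at h
  exact h.not_one_of_zero (h2 hx)

end Density

/-! ### Density along almost every line. -/

section Lines

variable {m : ℕ} {E : Set (EuclideanSpace ℝ (Fin (m + 1)))}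
    {J : ℝ × EuclideanSpace ℝ (Fin m) → EuclideanSpace ℝ (Fin (m + 1))}

theorem ae_forall_no_switch (hJ : MeasurePreserving J (volume.prod volume) volume)
    (hd : ∀ p q, dist (J p) (J q) ≤ |p.1 - q.1| + dist p.2 q.2)
    (hE : NullMeasurableSet E) {η : ℝ≥0∞}
    (hη : η * volume (Metric.closedBall (0 : EuclideanSpace ℝ (Fin (m + 1))) 4) <
      2⁻¹ * volume (Metric.closedBall (0 : EuclideanSpace ℝ (Fin m)) 1)) :
    ∀ᵐ y, ∀ k t, J (t, y) ∈ lowDensitySet E η k → ∀ δ > 0,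
      ¬ ∀ s ∈ Ioo t (t + δ), HasDensityAt E 1 (J (s, y)) := by
  have key : ∀ k : ℕ, ∀ᵐ y, y ∉ Prod.snd '' {p : ℝ × EuclideanSpace ℝ (Fin m) |
      J p ∈ lowDensitySet E η k ∧
      ∀ s ∈ Ioo (0 : ℝ) (1 / (k + 1)), J (p.1 + s, p.2) ∈ {x | HasDensityAt E 1 x}} := by
    intro k
    refine measure_eq_zero_iff_ae_notMem.1 ?_
    -- The estimate is applied to the set of density-one points, which agrees with `E` almost
    -- everywhere and so has the same volume in every ball.
    refine volume_image_snd_lowDensity_eq_zero hJ hd (by positivity) hη ?_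
    intro x hx r hr hrk
    refine le_trans (le_of_eq ?_) (hx r hr hrk)
    refine measure_congr ?_
    refine Filter.EventuallyEq.inter ?_ (ae_eq_refl _)
    exact Filter.EventuallyEq.symm (Filter.eventuallyEq_set.2 (ae_mem_iff_hasDensityAt_one hE))
  filter_upwards [ae_all_iff.2 key] with y hy k t ht δ hδ hs
  obtain ⟨l, hl⟩ := exists_nat_one_div_lt hδ
  refine hy (max k l) ⟨(t, y), ⟨lowDensitySet_mono η (le_max_left _ _) ht, fun s hs' => ?_⟩, rfl⟩
  refine hs _ ⟨by linarith [hs'.1], ?_⟩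
  have : (1 : ℝ) / ((max k l : ℕ) + 1) ≤ 1 / (l + 1) := Nat.one_div_le_one_div (le_max_right _ _)
  have := hs'.2
  dsimp only
  linarith

theorem measurePreserving_neg_fst (hJ : MeasurePreserving J (volume.prod volume) volume) :
    MeasurePreserving (fun p : ℝ × EuclideanSpace ℝ (Fin m) => J (-p.1, p.2))
      (volume.prod volume) volume :=
  hJ.comp ((Measure.measurePreserving_neg (volume : Measure ℝ)).prod (MeasurePreserving.id volume))

/-- Almost every line (in a given direction) of a set with negligible essential boundary consists
of points of density one or of points of density zero. -/
theorem ae_line_hasDensityAt (hJ : MeasurePreserving J (volume.prod volume) volume)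
    (hJc : Continuous J)
    (hd : ∀ p q, dist (J p) (J q) ≤ |p.1 - q.1| + dist p.2 q.2)
    (hE : NullMeasurableSet E) (h : ∀ᵐ y, ∀ t, J (t, y) ∉ essentialBoundary E) :
    ∀ᵐ y, (∀ t, HasDensityAt E 1 (J (t, y))) ∨ ∀ t, HasDensityAt E 0 (J (t, y)) := by
  obtain ⟨η, hη0, hη1, hη⟩ : ∃ η : ℝ≥0∞, 0 < η ∧ η < 1 ∧
      η * volume (Metric.closedBall (0 : EuclideanSpace ℝ (Fin (m + 1))) 4) <
      2⁻¹ * volume (Metric.closedBall (0 : EuclideanSpace ℝ (Fin m)) 1) := by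
    obtain ⟨c, hc, hlt⟩ := ENNReal.exists_nnreal_pos_mul_lt
      (a := volume (Metric.closedBall (0 : EuclideanSpace ℝ (Fin (m + 1))) 4))
      (b := 2⁻¹ * volume (Metric.closedBall (0 : EuclideanSpace ℝ (Fin m)) 1))
      measure_closedBall_lt_top.ne
      (mul_ne_zero (by simp) (Metric.measure_closedBall_pos volume _ one_pos).ne')
    refine ⟨min c 2⁻¹, lt_min (by exact_mod_cast hc) (by simp),
      (min_le_right _ _).trans_lt (by simp), lt_of_le_of_lt ?_ hlt⟩
    gcongr
    exact min_le_left _ _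
  -- Reversing the line turns left-sided switches into right-sided ones; with `E` and `Eᶜ` this
  -- makes four exceptional null sets.
  have hJ' := measurePreserving_neg_fst hJ
  have hd' : ∀ p q : ℝ × EuclideanSpace ℝ (Fin m),
      dist (J (-p.1, p.2)) (J (-q.1, q.2)) ≤ |p.1 - q.1| + dist p.2 q.2 := fun p q => by
    refine (hd _ _).trans (le_of_eq ?_)
    dsimp only
    rw [← abs_neg (p.1 - q.1)]
    congr 2
    ring
  filter_upwards [h, ae_forall_no_switch hJ hd hE hη, ae_forall_no_switch hJ' hd' hE hη,
    ae_forall_no_switch hJ hd hE.compl hη, ae_forall_no_switch hJ' hd' hE.compl hη]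
    with y hy h1 h2 h3 h4
  have hdich : ∀ t, HasDensityAt E 0 (J (t, y)) ∨ HasDensityAt E 1 (J (t, y)) := fun t => by
    have := hy t
    simp only [essentialBoundary, mem_ofPred_eq] at this
    tauto
  have hcompl : {t | HasDensityAt E 0 (J (t, y))}ᶜ = {t | HasDensityAt E 1 (J (t, y))} := by
    ext t
    exact ⟨fun h => (hdich t).resolve_left h, fun h h' => h'.not_one_of_zero h⟩
  have hJy : Continuous fun t : ℝ => J (t, y) := hJc.comp (by fun_prop)
  have hcl : ∀ (F : Set (EuclideanSpace ℝ (Fin (m + 1)))) (k : ℕ),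
      IsClosed {t | J (t, y) ∈ lowDensitySet F η k} := fun F k =>
    (isClosed_lowDensitySet (hη1.trans ENNReal.one_lt_top).ne k).preimage hJy
  have hneg : ∀ {F : Set (EuclideanSpace ℝ (Fin (m + 1)))} {t δ : ℝ},
      (∀ s ∈ Ioo (t - δ) t, HasDensityAt F 1 (J (s, y))) →
      ∀ s ∈ Ioo (-t) (-t + δ), HasDensityAt F 1 (J (-s, y)) := fun h s hs =>
    h _ ⟨by linarith [hs.2], by linarith [hs.1]⟩
  have hone : ∀ x, HasDensityAt Eᶜ 1 x ↔ HasDensityAt E 0 x := fun x => by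
    rw [← hasDensityAt_compl_zero_iff hE.compl, compl_compl]
  have hcase : {t | HasDensityAt E 0 (J (t, y))} = ∅ ∨
      {t | HasDensityAt E 0 (J (t, y))} = univ := by
    refine eq_empty_or_eq_univ_of_no_switch (hcl E) (hcl Eᶜ) ?_ ?_ ?_ ?_
    · ext t
      simp only [mem_iUnion, mem_ofPred_eq]
      exact ⟨fun ⟨k, hk⟩ => (hdich t).resolve_right (not_hasDensityAt_one_of_mem hη1 hk),
        fun h => h.exists_mem_lowDensitySet hη0⟩
    · rw [hcompl]
      ext t
      simp only [mem_iUnion, mem_ofPred_eq]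
      refine ⟨fun ⟨k, hk⟩ => (hdich t).resolve_left fun h0 =>
        not_hasDensityAt_one_of_mem hη1 hk ((hone _).2 h0), fun h => ?_⟩
      exact ((hasDensityAt_compl_zero_iff hE).2 h).exists_mem_lowDensitySet hη0
    · intro k t ht δ hδ
      rw [hcompl]
      refine ⟨fun h => h1 k t ht δ hδ fun s hs => h hs, fun h => h2 k (-t) ?_ δ hδ
        (hneg fun s hs => h hs)⟩
      rw [neg_neg]; exact ht
    · intro k t ht δ hδ
      refine ⟨fun h => h3 k t ht δ hδ fun s hs => (hone _).2 (h hs), fun h => h4 k (-t) ?_ δ hδ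
        (hneg fun s hs => (hone _).2 (h hs))⟩
      rw [neg_neg]; exact ht
  rcases hcase with h0 | h0
  · left
    rw [← compl_univ_iff, hcompl] at h0
    exact fun t => (eq_univ_iff_forall.1 h0 t)
  · right
    exact fun t => (eq_univ_iff_forall.1 h0 t)

end Lines

/-! ### Sets with negligible essential boundary are trivial. -/

section Translation

variable {m : ℕ} {E : Set (EuclideanSpace ℝ (Fin (m + 1)))}

theorem quasiMeasurePreserving_removeCoord (i : Fin (m + 1)) :
    Measure.QuasiMeasurePreserving (removeCoord (m := m) i) volume volume := by
  have hm : Measurable (removeCoord (m := m) i) := (lipschitzWith_removeCoord i).continuous.measurable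
  have hi := measurePreserving_insertCoord (m := m) i
  refine ⟨hm, ?_⟩
  rw [← hi.map_eq, Measure.map_map hm hi.measurable]
  have : removeCoord i ∘ insertCoord (m := m) i = Prod.snd := funext fun p => by simp
  rw [this]
  exact Measure.quasiMeasurePreserving_snd.absolutelyContinuous

/-- Forgetting a coordinate is 1-Lipschitz, so an `ℋᵐ`-null set has a Lebesgue-null shadow in `ℝᵐ`.
-/
theorem ae_line_notMem_of_euclideanHausdorffMeasure_eq_zero (i : Fin (m + 1))
    {S : Set (EuclideanSpace ℝ (Fin (m + 1)))}
    (hS : Measure.euclideanHausdorffMeasure m S = 0) :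
    ∀ᵐ y, ∀ t, insertCoord i (t, y) ∉ S := by
  have h0 : volume (removeCoord i '' S) = 0 := by
    rw [← EuclideanSpace.euclideanHausdorffMeasure_eq_volume]
    refine le_antisymm ((euclideanHausdorffMeasure_image_le
      (lipschitzWith_removeCoord i).lipschitzOnWith m).trans ?_) bot_le
    rw [hS, mul_zero]
  filter_upwards [measure_eq_zero_iff_ae_notMem.1 h0] with y hy t ht
  exact hy ⟨_, ht, by simp⟩

theorem preimage_single_vadd_ae_eq (hE : NullMeasurableSet E)
    (h : Measure.euclideanHausdorffMeasure m (essentialBoundary E) = 0) (i : Fin (m + 1)) (t : ℝ) :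
    (EuclideanSpace.single i t +ᵥ ·) ⁻¹' E =ᵐ[volume] E := by
  have hline := (quasiMeasurePreserving_removeCoord i).ae
    (ae_line_hasDensityAt (measurePreserving_insertCoord i) (continuous_insertCoord i)
      (dist_insertCoord_le i) hE (ae_line_notMem_of_euclideanHausdorffMeasure_eq_zero i h))
  have hE1 := ae_mem_iff_hasDensityAt_one hE
  have hE2 := (measurePreserving_add_left volume
    (EuclideanSpace.single i t)).quasiMeasurePreserving.ae hE1
  refine Filter.eventuallyEq_set.2 ?_
  filter_upwards [hline, hE1, hE2] with x hx h1 h2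
  rw [mem_preimage, vadd_eq_add, h2, h1, add_comm (EuclideanSpace.single i t) x]
  have hxt : x + EuclideanSpace.single i t = insertCoord i (x i + t, removeCoord i x) := by
    rw [← insertCoord_add_single i (x i, removeCoord i x), insertCoord_removeCoord]
  rw [hxt]
  rcases hx with hx | hx
  · have h3 := hx (x i)
    rw [insertCoord_removeCoord] at h3
    exact iff_of_true (hx _) h3
  · have h3 := hx (x i)
    rw [insertCoord_removeCoord] at h3
    exact iff_of_false (hx _).not_one_of_zero h3.not_one_of_zero

/-- A set whose essential boundary is `ℋⁿ⁻¹`-negligible is null or conull. -/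
theorem ae_mem_or_ae_notMem_of_essentialBoundary_null (hE : NullMeasurableSet E)
    (h : Measure.euclideanHausdorffMeasure m (essentialBoundary E) = 0) :
    (∀ᵐ x, x ∈ E) ∨ ∀ᵐ x, x ∉ E := by
  refine eventuallyConst_set.1
    (aeconst_of_forall_preimage_vadd_ae_eq (EuclideanSpace ℝ (Fin (m + 1))) hE fun g => ?_)
  have hg : g = ∑ i, EuclideanSpace.single i (g i) := by
    ext j
    simp [Finset.sum_apply]
  rw [hg]
  refine Finset.sum_induction _
    (fun g : EuclideanSpace ℝ (Fin (m + 1)) => (g +ᵥ ·) ⁻¹' E =ᵐ[volume] E) ?_ ?_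
    fun i _ => preimage_single_vadd_ae_eq hE h i _
  · intro a b ha hb
    have hq : Measure.QuasiMeasurePreserving (b +ᵥ · : EuclideanSpace ℝ (Fin (m + 1)) → _)
      volume volume := (measurePreserving_add_left volume b).quasiMeasurePreserving
    have := (hq.preimage_ae_eq ha).trans hb
    simpa only [← preimage_comp, Function.comp_def, vadd_vadd] using this
  · simp only [zero_vadd]
    exact ae_eq_refl _

end Translation

/-- A set of finite positive weighted volume has positive weighted perimeter, provided that the
density has infinite total volume. -/
theorem weightedPerimeter_ne_zero {m : ℕ} {f : EuclideanSpace ℝ (Fin (m + 1)) → ℝ}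
    (hf : IsDensity f) (htot : ∫⁻ x, ENNReal.ofReal (f x) = ∞)
    {E : Set (EuclideanSpace ℝ (Fin (m + 1)))} (hE : NullMeasurableSet E)
    (h0 : weightedVolume f E ≠ 0) (htop : weightedVolume f E ≠ ∞) :
    weightedPerimeter f E ≠ 0 := by
  intro hP
  have hmeas : Measurable fun x => ENNReal.ofReal (f x) :=
    hf.lowerSemicontinuous.measurable.ennreal_ofReal
  have hnull : Measure.euclideanHausdorffMeasure m (essentialBoundary E) = 0 := by
    rw [weightedPerimeter, lintegral_eq_zero_iff hmeas, Nat.add_sub_cancel] at hP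
    rw [← Measure.restrict_eq_zero, ← ae_eq_bot, ← eventually_false_iff_eq_bot]
    filter_upwards [hP] with x hx
    have := hf.pos x
    simp only [Pi.zero_apply, ENNReal.ofReal_eq_zero] at hx
    linarith
  rcases ae_mem_or_ae_notMem_of_essentialBoundary_null hE hnull with h | h
  · apply htop
    rw [weightedVolume, Measure.restrict_eq_self_of_ae_mem h, htot]
  · apply h0
    rw [weightedVolume, Measure.restrict_eq_zero.2 (measure_eq_zero_iff_ae_notMem.2 h),
      lintegral_zero_measure]

/-! ### Bounded convex sets have locally finite perimeter. -/

theorem abs_setIntegral_deriv_le {s : Set ℝ} (hs : s.OrdConnected) (hb : Bornology.IsBounded s)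
    {u u' : ℝ → ℝ} (hu : ∀ t, HasDerivAt u (u' t) t) (hu' : Continuous u')
    (h1 : ∀ t, |u t| ≤ 1) : |∫ t in s, u' t| ≤ 2 := by
  rcases s.eq_empty_or_nonempty with rfl | hne
  · simp
  have hbb := hb.bddBelow
  have hba := hb.bddAbove
  have hab : sInf s ≤ sSup s := csInf_le_csSup hne hbb hba
  have hsub : s ⊆ Icc (sInf s) (sSup s) := fun t ht => ⟨csInf_le hbb ht, le_csSup hba ht⟩
  have hsup : Ioo (sInf s) (sSup s) ⊆ s :=
    IsConnected.Ioo_csInf_csSup_subset ⟨hne, hs.isPreconnected⟩ hbb hba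
  have hae : s =ᵐ[volume] Ioc (sInf s) (sSup s) := by
    refine Filter.EventuallyLE.antisymm ?_ ?_
    · exact (LE.le.eventuallyLE hsub).trans Ioc_ae_eq_Icc.symm.le
    · exact Ioo_ae_eq_Ioc.symm.le.trans (LE.le.eventuallyLE hsup)
  rw [setIntegral_congr_set hae, ← intervalIntegral.integral_of_le hab,
    intervalIntegral.integral_eq_sub_of_hasDerivAt (fun t _ => hu t) (hu'.intervalIntegrable _ _)]
  have := abs_sub (u (sSup s)) (u (sInf s))
  linarith [h1 (sSup s), h1 (sInf s)]

section Convex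

variable {m : ℕ} {E : Set (EuclideanSpace ℝ (Fin (m + 1)))}

theorem insertCoord_eq_add_smul (i : Fin (m + 1)) (t : ℝ) (y : EuclideanSpace ℝ (Fin m)) :
    insertCoord i (t, y) = insertCoord i (0, y) + t • EuclideanSpace.single i (1 : ℝ) := by
  have := insertCoord_add_single i (0, y) t
  rw [zero_add] at this
  rw [← this]
  congr 1
  ext j
  simp [PiLp.single_apply]

theorem hasDerivAt_comp_insertCoord (i : Fin (m + 1)) (y : EuclideanSpace ℝ (Fin m))
    {φ : EuclideanSpace ℝ (Fin (m + 1)) → EuclideanSpace ℝ (Fin (m + 1))}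
    (hφ : ContDiff ℝ 1 φ) (t : ℝ) :
    HasDerivAt (fun t : ℝ => φ (insertCoord i (t, y)) i)
      (fderiv ℝ φ (insertCoord i (t, y)) (EuclideanSpace.single i 1) i) t := by
  have h1 : HasDerivAt (fun t : ℝ => insertCoord i (t, y)) (EuclideanSpace.single i (1 : ℝ)) t := by
    rw [funext fun t => insertCoord_eq_add_smul i t y]
    simpa using ((hasDerivAt_id t).smul_const (EuclideanSpace.single i (1 : ℝ))).const_add
      (insertCoord i (0, y))
  have h2 := ((hφ.differentiable one_ne_zero).differentiableAt
    (x := insertCoord i (t, y))).hasFDerivAt.comp_hasDerivAt t h1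
  exact (EuclideanSpace.proj (𝕜 := ℝ) i).hasFDerivAt.comp_hasDerivAt
    t h2

theorem continuous_fderiv_apply {φ : EuclideanSpace ℝ (Fin (m + 1)) →
    EuclideanSpace ℝ (Fin (m + 1))} (hφ : ContDiff ℝ 1 φ) (i : Fin (m + 1)) :
    Continuous fun x => fderiv ℝ φ x (EuclideanSpace.single i 1) i := by
  have h1 : Continuous fun x => fderiv ℝ φ x (EuclideanSpace.single i 1) :=
    (hφ.continuous_fderiv one_ne_zero).clm_apply continuous_const
  exact (EuclideanSpace.proj (𝕜 := ℝ) i).continuous.comp h1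

/-- By Fubini: each line meets the convex set in an interval, over which the derivative integrates
to a difference of two values in `[-1, 1]`, and only lines over the ball of radius `R` contribute.
-/
theorem abs_setIntegral_fderiv_le (hE : MeasurableSet E) (hc : Convex ℝ E) {R : ℝ}
    (hR : E ⊆ Metric.closedBall 0 R)
    {φ : EuclideanSpace ℝ (Fin (m + 1)) → EuclideanSpace ℝ (Fin (m + 1))}
    (hφ : ContDiff ℝ 1 φ) (h1 : ∀ x, ‖φ x‖ ≤ 1) (i : Fin (m + 1)) :
    |∫ x in E, fderiv ℝ φ x (EuclideanSpace.single i 1) i| ≤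
      ∫ _y in Metric.closedBall (0 : EuclideanSpace ℝ (Fin m)) R, (2 : ℝ) := by
  have hcont := continuous_fderiv_apply hφ i
  set g := fun x => fderiv ℝ φ x (EuclideanSpace.single i 1) i with hg
  have hint : Integrable (E.indicator g) := by
    rw [integrable_indicator_iff hE]
    exact (hcont.continuousOn.integrableOn_compact (isCompact_closedBall _ _)).mono_set hR
  have hJ := measurePreserving_insertCoord (m := m) i
  have hint' : Integrable (fun p => E.indicator g (insertCoord i p))
      ((volume : Measure ℝ).prod (volume : Measure (EuclideanSpace ℝ (Fin m)))) :=
    hJ.integrable_comp_of_integrable hint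
  have hfub : ∫ x in E, g x = ∫ y, ∫ t, E.indicator g (insertCoord i (t, y)) := by
    rw [← integral_indicator hE, ← hJ.map_eq, integral_map hJ.measurable.aemeasurable
      (by rw [hJ.map_eq]; exact hint.aestronglyMeasurable), integral_prod_symm _ hint']
  have hdist : ∀ p : ℝ × EuclideanSpace ℝ (Fin m), insertCoord i p ∈ E →
      p.2 ∈ Metric.closedBall 0 R ∧ p.1 ∈ Metric.closedBall 0 R := by
    intro p hp
    have hp' := hR hp
    have h0 := norm_sq_coord i (insertCoord i p)
    simp only [Metric.mem_closedBall, dist_zero_right, removeCoord_insertCoord,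
      insertCoord_same] at hp' h0 ⊢
    have hn := norm_nonneg (insertCoord i p)
    refine ⟨le_trans ?_ hp', le_trans ?_ hp'⟩
    · exact (sq_le_sq₀ (norm_nonneg _) hn).1 (by nlinarith [sq_nonneg p.1])
    · refine (sq_le_sq₀ (norm_nonneg _) hn).1 ?_
      rw [Real.norm_eq_abs, sq_abs]
      nlinarith [sq_nonneg ‖p.2‖]
  rw [hfub, ← integral_indicator measurableSet_closedBall, ← Real.norm_eq_abs]
  refine norm_integral_le_of_norm_le
    ((integrable_indicator_iff measurableSet_closedBall).2
      (integrableOn_const measure_closedBall_lt_top.ne)) (ae_of_all _ fun y => ?_)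
  set s := {t : ℝ | insertCoord i (t, y) ∈ E} with hs
  have hsm : MeasurableSet s :=
    ((continuous_insertCoord i).comp (by fun_prop : Continuous fun t : ℝ => (t, y))).measurable hE
  have hslice : (fun t => E.indicator g (insertCoord i (t, y))) =
      s.indicator fun t => g (insertCoord i (t, y)) := by
    ext t
    by_cases ht : insertCoord i (t, y) ∈ E
    · rw [indicator_of_mem ht, indicator_of_mem (show t ∈ s from ht)]
    · rw [indicator_of_notMem ht, indicator_of_notMem (show t ∉ s from ht)]
  rw [hslice, integral_indicator hsm, Real.norm_eq_abs]
  by_cases hy : y ∈ Metric.closedBall (0 : EuclideanSpace ℝ (Fin m)) R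
  · rw [indicator_of_mem hy]
    have hsc : Convex ℝ s := by
      intro t ht t' ht' a b ha hb hab
      have := hc ht ht' ha hb hab
      rw [hs, mem_ofPred_eq]
      convert this using 1
      refine ext_coord i (by simp) fun j => ?_
      simp only [insertCoord_succAbove, PiLp.add_apply, PiLp.smul_apply, smul_eq_mul]
      rw [← add_mul, hab, one_mul]
    refine abs_setIntegral_deriv_le hsc.ordConnected
      (Metric.isBounded_closedBall.subset fun t ht => (hdist (t, y) ht).2)
      (u := fun t => φ (insertCoord i (t, y)) i) (fun t => hasDerivAt_comp_insertCoord i y hφ t)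
      (hcont.comp ((continuous_insertCoord i).comp (by fun_prop))) fun t => ?_
    exact (PiLp.norm_apply_le (φ (insertCoord i (t, y))) i).trans (h1 _)
  · have : s = ∅ := eq_empty_of_forall_notMem fun t ht => hy (hdist (t, y) ht).1
    rw [this, indicator_of_notMem hy]
    simp

/-- Bounded measurable convex sets have locally finite perimeter. -/
theorem hasLocallyFinitePerimeter_of_convex (hE : MeasurableSet E) (hc : Convex ℝ E)
    (hb : Bornology.IsBounded E) : HasLocallyFinitePerimeter E := by
  refine ⟨hE.nullMeasurableSet, fun K _ => ?_⟩
  obtain ⟨R, hR⟩ := hb.subset_closedBall 0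
  refine ⟨∑ _i : Fin (m + 1), ∫ _y in Metric.closedBall (0 : EuclideanSpace ℝ (Fin m)) R, (2 : ℝ),
    fun φ hφ _ h1 => ?_⟩
  simp only [divergence]
  rw [integral_finsetSum _ fun i _ => ((continuous_fderiv_apply hφ
    i).continuousOn.integrableOn_compact (isCompact_closedBall 0 R)).mono_set hR]
  exact Finset.sum_le_sum fun i _ =>
    (le_abs_self _).trans (abs_setIntegral_fderiv_le hE hc hR hφ h1 i)

end Convex

/-! ### Topological frontier and coordinate boxes. -/

theorem essentialBoundary_subset_frontier {n : ℕ} (E : Set (EuclideanSpace ℝ (Fin n))) :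
    essentialBoundary E ⊆ frontier E := by
  intro x hx
  by_contra hxf
  have hev : ∀ {U : Set (EuclideanSpace ℝ (Fin n))}, U ∈ 𝓝 x →
      ∀ᶠ r : ℝ in 𝓝[>] 0, 0 < r ∧ Metric.closedBall x r ⊆ U := by
    intro U hU
    obtain ⟨ε, hε, hsub⟩ := Metric.nhds_basis_closedBall.mem_iff.1 hU
    filter_upwards [self_mem_nhdsWithin, mem_nhdsWithin_of_mem_nhds (Iio_mem_nhds hε)] with r hr hr'
    exact ⟨hr, (Metric.closedBall_subset_closedBall (le_of_lt hr')).trans hsub⟩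
  by_cases hxi : x ∈ interior E
  · refine hx.2 ((tendsto_congr' ?_).2 tendsto_const_nhds)
    filter_upwards [hev (mem_interior_iff_mem_nhds.1 hxi)] with r hr
    rw [inter_eq_self_of_subset_right hr.2, ENNReal.div_self
      (Metric.measure_closedBall_pos volume x hr.1).ne' measure_closedBall_lt_top.ne]
  · have hxc : x ∉ closure E := fun h => hxf ⟨h, hxi⟩
    refine hx.1 ((tendsto_congr' ?_).2 tendsto_const_nhds)
    filter_upwards [hev (isClosed_closure.isOpen_compl.mem_nhds hxc)] with r hr
    have : E ∩ Metric.closedBall x r = ∅ :=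
      eq_empty_of_forall_notMem fun y hy => hr.2 hy.2 (subset_closure hy.1)
    rw [this, measure_empty, ENNReal.zero_div]

theorem volume_euclidean_box {k : ℕ} (u v : Fin k → ℝ) :
    volume {y : EuclideanSpace ℝ (Fin k) | ∀ i, y i ∈ Icc (u i) (v i)} =
      ∏ i, ENNReal.ofReal (v i - u i) := by
  have h := (PiLp.volume_preserving_ofLp (Fin k)).measure_preimage
    (measurableSet_Icc (a := u) (b := v)).nullMeasurableSet
  rw [Real.volume_Icc_pi] at h
  rw [← h]
  congr 1
  ext y
  simp [Pi.le_def, forall_and]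

theorem volume_euclidean_open_box {k : ℕ} (u v : Fin k → ℝ) :
    volume {y : EuclideanSpace ℝ (Fin k) | ∀ i, y i ∈ Ioo (u i) (v i)} =
      ∏ i, ENNReal.ofReal (v i - u i) := by
  have h := (PiLp.volume_preserving_ofLp (Fin k)).measure_preimage
    (MeasurableSet.univ_pi fun i => measurableSet_Ioo (a := u i) (b := v i)).nullMeasurableSet
  rw [Real.volume_pi_Ioo] at h
  rw [← h]
  congr 1
  ext y
  simp

theorem isBounded_of_forall_abs_le {k : ℕ} {S : Set (EuclideanSpace ℝ (Fin k))} (C : ℝ)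
    (h : ∀ x ∈ S, ∀ i, |x i| ≤ C) : Bornology.IsBounded S := by
  refine isBounded_iff_forall_norm_le.2 ⟨√(∑ _i : Fin k, C ^ 2), fun x hx => ?_⟩
  rw [EuclideanSpace.norm_eq]
  refine Real.sqrt_le_sqrt (Finset.sum_le_sum fun i _ => ?_)
  exact pow_le_pow_left₀ (norm_nonneg _) (h x hx i) 2

/-! ### Cones and frusta: volume and area of the faces. -/

section Cone

variable {l : ℕ} {ρ a b : ℝ}

/-- The truncated open cone over a cube, around the first coordinate axis. -/
def cone (l : ℕ) (ρ a : ℝ) : Set (EuclideanSpace ℝ (Fin (l + 2))) :=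
  {x | a < x 0 ∧ ∀ j : Fin (l + 1), |x j.succ| < ρ * x 0}

/-- The part of the cone below height `b`. -/
def frustum (l : ℕ) (ρ a b : ℝ) : Set (EuclideanSpace ℝ (Fin (l + 2))) :=
  cone l ρ a ∩ {x | x 0 < b}

theorem isOpen_cone : IsOpen (cone l ρ a) := by
  have : cone l ρ a = {x | a < x 0} ∩ ⋂ j : Fin (l + 1), {x | |x j.succ| < ρ * x 0} := by
    ext x; simp [cone]
  rw [this]
  refine (isOpen_lt (by fun_prop) (by fun_prop)).inter
    (isOpen_iInter_of_finite fun j => isOpen_lt (by fun_prop) (by fun_prop))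

theorem isOpen_frustum : IsOpen (frustum l ρ a b) :=
  isOpen_cone.inter (isOpen_lt (by fun_prop) (by fun_prop))

theorem smul_mem_cone (ha : 0 ≤ a) {x : EuclideanSpace ℝ (Fin (l + 2))} (hx : x ∈ cone l ρ a)
    {t : ℝ} (ht : 1 ≤ t) : t • x ∈ cone l ρ a := by
  refine ⟨?_, fun j => ?_⟩
  · simp only [PiLp.smul_apply, smul_eq_mul]
    have := hx.1
    nlinarith
  · simp only [PiLp.smul_apply, smul_eq_mul]
    rw [abs_mul, abs_of_pos (by linarith), mul_left_comm]
    exact mul_lt_mul_of_pos_left (hx.2 j) (by linarith)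

theorem convex_frustum : Convex ℝ (frustum l ρ a b) := by
  intro x hx y hy s t hs ht hst
  have ht' : t = 1 - s := by linarith
  have key : ∀ u v c d : ℝ, u < c → v < d → s * u + t * v < s * c + t * d := by
    intro u v c d h1 h2
    rcases hs.eq_or_lt with h | h
    · have : t = 1 := by linarith
      rw [this, ← h]; linarith
    · nlinarith
  have hc : ∀ c : ℝ, s * c + t * c = c := fun c => by rw [← add_mul, hst, one_mul]
  refine ⟨⟨?_, fun j => ?_⟩, ?_⟩
  · have := key _ _ _ _ hx.1.1 hy.1.1
    rw [hc] at this
    simpa using this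
  · have h1 := key _ _ _ _ (hx.1.2 j) (hy.1.2 j)
    simp only [PiLp.add_apply, PiLp.smul_apply, smul_eq_mul]
    refine ((abs_add_le _ _).trans_lt ?_).trans_eq (by ring : s * (ρ * x 0) + t * (ρ * y 0) = _)
    rwa [abs_mul, abs_mul, abs_of_nonneg hs, abs_of_nonneg ht]
  · have := key _ _ _ _ hx.2 hy.2
    rw [hc] at this
    simpa using this

theorem frustum_subset_box (hρ : 0 ≤ ρ) (ha : 0 ≤ a) :
    frustum l ρ a b ⊆ {x | ∀ i, x i ∈ Icc ((Fin.cons 0 fun _ => -(ρ * b) : Fin (l + 2) → ℝ) i)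
      ((Fin.cons b fun _ => ρ * b : Fin (l + 2) → ℝ) i)} := by
  intro x hx i
  have hxb : x 0 < b := hx.2
  have hxa : a < x 0 := hx.1.1
  refine Fin.cases ?_ (fun j => ?_) i
  · simp only [Fin.cons_zero]; exact ⟨by linarith, by linarith⟩
  · simp only [Fin.cons_succ]
    refine abs_le.1 ((hx.1.2 j).le.trans ?_)
    gcongr

theorem isBounded_frustum (hρ : 0 ≤ ρ) (ha : 0 ≤ a) :
    Bornology.IsBounded (frustum l ρ a b) := by
  refine isBounded_of_forall_abs_le (|b| + |ρ * b|) fun x hx i => ?_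
  have := frustum_subset_box hρ ha hx i
  revert this
  refine Fin.cases ?_ (fun j => ?_) i
  · simp only [Fin.cons_zero]
    intro h
    rw [abs_of_nonneg h.1]
    linarith [h.2, le_abs_self b, abs_nonneg (ρ * b)]
  · simp only [Fin.cons_succ]
    intro h
    linarith [abs_le.2 h, le_abs_self (ρ * b), abs_nonneg b]

theorem volume_frustum_le (hρ : 0 ≤ ρ) (ha : 0 ≤ a) (hb : 0 ≤ b) :
    volume (frustum l ρ a b) ≤ ENNReal.ofReal (b * (2 * (ρ * b)) ^ (l + 1)) := by
  refine (measure_mono (frustum_subset_box hρ ha)).trans_eq ?_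
  rw [volume_euclidean_box, Fin.prod_univ_succ]
  simp only [Fin.cons_zero, Fin.cons_succ, sub_zero, sub_neg_eq_add, ← two_mul, Finset.prod_const,
    Finset.card_univ, Fintype.card_fin]
  rw [ENNReal.ofReal_mul hb, ENNReal.ofReal_pow (by positivity)]

/-- The frustum contains the box whose cross-section is the one at its lowest height. -/
theorem le_volume_frustum (hρ : 0 ≤ ρ) (ha : 0 ≤ a) (hab : a ≤ b) :
    ENNReal.ofReal ((b - a) * (2 * (ρ * a)) ^ (l + 1)) ≤ volume (frustum l ρ a b) := by
  have hsub : {x : EuclideanSpace ℝ (Fin (l + 2)) |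
      ∀ i, x i ∈ Ioo ((Fin.cons a fun _ => -(ρ * a) : Fin (l + 2) → ℝ) i)
      ((Fin.cons b fun _ => ρ * a : Fin (l + 2) → ℝ) i)} ⊆ frustum l ρ a b := by
    intro x hx
    have h0 := hx 0
    simp only [Fin.cons_zero] at h0
    refine ⟨⟨h0.1, fun j => ?_⟩, h0.2⟩
    have hj := hx j.succ
    simp only [Fin.cons_succ] at hj
    refine (abs_lt.2 hj).trans_le ?_
    have := h0.1
    gcongr
  refine le_trans (le_of_eq ?_) (measure_mono hsub)
  rw [volume_euclidean_open_box, Fin.prod_univ_succ]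
  simp only [Fin.cons_zero, Fin.cons_succ, sub_neg_eq_add, ← two_mul, Finset.prod_const,
    Finset.card_univ, Fintype.card_fin]
  rw [ENNReal.ofReal_mul (by linarith), ENNReal.ofReal_pow (by positivity)]

/-- The horizontal section of the closed cone at height `c`. -/
def horizontalFace (l : ℕ) (ρ c : ℝ) : Set (EuclideanSpace ℝ (Fin (l + 2))) :=
  {x | x 0 = c ∧ ∀ j : Fin (l + 1), |x j.succ| ≤ ρ * c}

/-- The lateral face `x_{j+1} = σ x_0` of the frustum. -/
def lateralFace (l : ℕ) (ρ a b : ℝ) (σ : ℝ) (j : Fin (l + 1)) :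
    Set (EuclideanSpace ℝ (Fin (l + 2))) :=
  {x | x j.succ = σ * x 0 ∧ x 0 ∈ Icc a b ∧ ∀ k : Fin (l + 1), |x k.succ| ≤ ρ * b}

theorem hausdorff_horizontalFace_le (c : ℝ) (hρc : 0 ≤ ρ * c) :
    Measure.euclideanHausdorffMeasure (l + 1) (horizontalFace l ρ c) ≤
      ENNReal.ofReal ((2 * (ρ * c)) ^ (l + 1)) := by
  set B := {y : EuclideanSpace ℝ (Fin (l + 1)) | ∀ i, y i ∈ Icc (-(ρ * c)) (ρ * c)} with hB
  have hsub : horizontalFace l ρ c ⊆ (fun y => insertCoord 0 (c, y)) '' B := by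
    intro x hx
    refine ⟨removeCoord 0 x, fun j => abs_le.1 (hx.2 j), ?_⟩
    dsimp only
    rw [← hx.1, insertCoord_removeCoord]
  have hL : LipschitzOnWith 1 (fun y : EuclideanSpace ℝ (Fin (l + 1)) => insertCoord 0 (c, y)) B :=
    LipschitzWith.lipschitzOnWith <| LipschitzWith.of_dist_le_mul fun y z => by
      simpa using dist_insertCoord_le 0 (c, y) (c, z)
  refine (measure_mono hsub).trans ((euclideanHausdorffMeasure_image_le hL _).trans_eq ?_)
  rw [EuclideanSpace.euclideanHausdorffMeasure_eq_volume, hB,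
    volume_euclidean_box (fun _ => -(ρ * c)) (fun _ => ρ * c)]
  simp only [sub_neg_eq_add, ← two_mul, Finset.prod_const, Finset.card_univ, Fintype.card_fin,
    ENNReal.coe_one, one_pow, one_mul]
  rw [ENNReal.ofReal_pow (by positivity)]

/-- The face is contained in the image of a box under the graph map `x_{j+1} = σ x_0`, which is
2-Lipschitz since `|σ| ≤ 1`; hence the factor `2 ^ (l + 1)`. -/
theorem hausdorff_lateralFace_le {σ : ℝ} (hσ : |σ| ≤ 1) (j : Fin (l + 1)) (hρb : 0 ≤ ρ * b)
    (hab : a ≤ b) :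
    Measure.euclideanHausdorffMeasure (l + 1) (lateralFace l ρ a b σ j) ≤
      ENNReal.ofReal (2 ^ (l + 1) * ((b - a) * (2 * (ρ * b)) ^ l)) := by
  set B := {y : EuclideanSpace ℝ (Fin (l + 1)) |
    ∀ i, y i ∈ Icc ((Fin.cons a fun _ => -(ρ * b) : Fin (l + 1) → ℝ) i)
      ((Fin.cons b fun _ => ρ * b : Fin (l + 1) → ℝ) i)} with hB
  have hsub : lateralFace l ρ a b σ j ⊆ (fun y => insertCoord j.succ (σ * y 0, y)) '' B := by
    intro x hx
    refine ⟨removeCoord j.succ x, fun i => ?_, ?_⟩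
    · refine Fin.cases ?_ (fun k => ?_) i
      · simpa using hx.2.1
      · simp only [Fin.cons_succ, removeCoord_apply, Fin.succ_succAbove_succ]
        exact abs_le.1 (hx.2.2 _)
    · have h0 : removeCoord j.succ x 0 = x 0 := by simp
      dsimp only
      rw [h0, ← hx.1, insertCoord_removeCoord]
  have hL : LipschitzOnWith 2
      (fun y : EuclideanSpace ℝ (Fin (l + 1)) => insertCoord j.succ (σ * y 0, y)) B := by
    refine LipschitzWith.lipschitzOnWith <| LipschitzWith.of_dist_le_mul fun y z => ?_
    refine (dist_insertCoord_le _ _ _).trans ?_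
    have h1 : |y 0 - z 0| ≤ dist y z := by
      rw [dist_eq_norm]; exact PiLp.norm_apply_le (y - z) 0
    dsimp only
    rw [← mul_sub, abs_mul, NNReal.coe_ofNat, two_mul]
    gcongr
    exact (mul_le_of_le_one_left (abs_nonneg _) hσ).trans h1
  refine (measure_mono hsub).trans ((euclideanHausdorffMeasure_image_le hL _).trans_eq ?_)
  rw [EuclideanSpace.euclideanHausdorffMeasure_eq_volume, hB, volume_euclidean_box,
    Fin.prod_univ_succ]
  simp only [Fin.cons_zero, Fin.cons_succ, sub_neg_eq_add, ← two_mul, Finset.prod_const,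
    Finset.card_univ, Fintype.card_fin]
  rw [ENNReal.ofReal_mul (p := 2 ^ (l + 1)) (by positivity),
    ENNReal.ofReal_mul (p := b - a) (by linarith),
    ENNReal.ofReal_pow (p := 2) (by positivity), ENNReal.ofReal_pow (p := 2 * _) (by positivity)]
  simp

/-- The part of the boundary of the frustum lying outside of the open cone. -/
def lowerFaces (l : ℕ) (ρ a b : ℝ) : Set (EuclideanSpace ℝ (Fin (l + 2))) :=
  (closure (frustum l ρ a b) \ cone l ρ a)

theorem mem_closure_frustum {x : EuclideanSpace ℝ (Fin (l + 2))}
    (hx : x ∈ closure (frustum l ρ a b)) :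
    x 0 ∈ Icc a b ∧ ∀ j : Fin (l + 1), |x j.succ| ≤ ρ * x 0 := by
  have hcl : IsClosed {x : EuclideanSpace ℝ (Fin (l + 2)) |
      x 0 ∈ Icc a b ∧ ∀ j : Fin (l + 1), |x j.succ| ≤ ρ * x 0} := by
    refine (isClosed_Icc.preimage (by fun_prop : Continuous fun x :
      EuclideanSpace ℝ (Fin (l + 2)) => x 0)).inter ?_
    have : {x : EuclideanSpace ℝ (Fin (l + 2)) | ∀ j : Fin (l + 1), |x j.succ| ≤ ρ * x 0} =
        ⋂ j : Fin (l + 1), {x | |x j.succ| ≤ ρ * x 0} := by ext x; simp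
    change IsClosed {x : EuclideanSpace ℝ (Fin (l + 2)) |
      ∀ j : Fin (l + 1), |x j.succ| ≤ ρ * x 0}
    rw [this]
    exact isClosed_iInter fun j => isClosed_le (by fun_prop) (by fun_prop)
  refine closure_minimal (fun y hy => ?_) hcl hx
  exact ⟨⟨hy.1.1.le, le_of_lt hy.2⟩, fun j => (hy.1.2 j).le⟩

/-- The cone is open, so a frontier point inside it can only come from the cut at height `b`. This
isolates the top face as the only one where raising the density is felt. -/
theorem frontier_frustum_subset :
    frontier (frustum l ρ a b) ⊆ lowerFaces l ρ a b ∪ horizontalFace l ρ b := by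
  intro x hx
  have hxc := mem_closure_frustum hx.1
  by_cases hco : x ∈ cone l ρ a
  · right
    have hxb : x 0 = b := by
      refine le_antisymm hxc.1.2 (not_lt.1 fun h => ?_)
      exact hx.2 (isOpen_frustum.interior_eq.symm ▸ ⟨hco, h⟩)
    exact ⟨hxb, fun j => hxb ▸ hxc.2 j⟩
  · exact Or.inl ⟨hx.1, hco⟩

theorem lowerFaces_subset (hρ : 0 ≤ ρ) :
    lowerFaces l ρ a b ⊆ horizontalFace l ρ a ∪
      ⋃ j, (lateralFace l ρ a b ρ j ∪ lateralFace l ρ a b (-ρ) j) := by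
  rintro x ⟨hx, hco⟩
  obtain ⟨h0, hj⟩ := mem_closure_frustum hx
  by_cases hxa : x 0 = a
  · exact Or.inl ⟨hxa, fun j => hxa ▸ hj j⟩
  · right
    have hlt : a < x 0 := lt_of_le_of_ne h0.1 (Ne.symm hxa)
    have : ∃ j : Fin (l + 1), ρ * x 0 ≤ |x j.succ| := by
      by_contra! h
      exact hco ⟨hlt, h⟩
    obtain ⟨j, hjx⟩ := this
    have hk : ∀ k : Fin (l + 1), |x k.succ| ≤ ρ * b := fun k => (hj k).trans (by
      have := h0.2
      gcongr)
    refine mem_iUnion.2 ⟨j, ?_⟩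
    have heq : |x j.succ| = ρ * x 0 := le_antisymm (hj j) hjx
    rcases abs_cases (x j.succ) with h | h
    · exact Or.inl ⟨by linarith, h0, hk⟩
    · exact Or.inr ⟨by linarith, h0, hk⟩

theorem hausdorff_lowerFaces_le (hρ : 0 ≤ ρ) (hρ1 : ρ ≤ 1) (ha : 0 ≤ a) (hab : a ≤ b) :
    Measure.euclideanHausdorffMeasure (l + 1) (lowerFaces l ρ a b) ≤
      ENNReal.ofReal ((2 * (ρ * a)) ^ (l + 1) +
        (l + 1) * (2 * (2 ^ (l + 1) * ((b - a) * (2 * (ρ * b)) ^ l)))) := by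
  have hb : 0 ≤ b := ha.trans hab
  have hba : 0 ≤ b - a := by linarith
  rw [ENNReal.ofReal_add (by positivity) (by positivity)]
  refine (measure_mono (lowerFaces_subset hρ)).trans ((measure_union_le _ _).trans ?_)
  refine add_le_add (hausdorff_horizontalFace_le _ (by positivity)) ?_
  refine (measure_iUnion_fintype_le _ _).trans ?_
  refine (Finset.sum_le_card_nsmul _ _
    (ENNReal.ofReal (2 * (2 ^ (l + 1) * ((b - a) * (2 * (ρ * b)) ^ l)))) fun j _ => ?_).trans_eq ?_
  · rw [two_mul (2 ^ (l + 1) * _), ENNReal.ofReal_add (by positivity) (by positivity)]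
    refine (measure_union_le _ _).trans (add_le_add ?_ ?_)
    · exact hausdorff_lateralFace_le (by rwa [abs_of_nonneg hρ]) j (by positivity) hab
    · exact hausdorff_lateralFace_le (by rwa [abs_neg, abs_of_nonneg hρ]) j (by positivity) hab
  · rw [Finset.card_univ, Fintype.card_fin, nsmul_eq_mul, ← Nat.cast_add_one,
      ENNReal.ofReal_mul (p := ((l + 1 : ℕ) : ℝ)) (Nat.cast_nonneg _), ENNReal.ofReal_natCast]

end Cone

/-! ### Raising a density on a thin cone. -/

section Stage

variable {l : ℕ}

/-- Raise `f` by the constant `c` on a cone. -/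
noncomputable def raise (f : EuclideanSpace ℝ (Fin (l + 2)) → ℝ) (ρ a c : ℝ) :
    EuclideanSpace ℝ (Fin (l + 2)) → ℝ :=
  fun x => f x + (cone l ρ a).indicator (fun _ => c) x

theorem raise_of_mem {f : EuclideanSpace ℝ (Fin (l + 2)) → ℝ} {ρ a c : ℝ}
    {x : EuclideanSpace ℝ (Fin (l + 2))} (hx : x ∈ cone l ρ a) : raise f ρ a c x = f x + c := by
  rw [raise, indicator_of_mem hx]

theorem raise_of_notMem {f : EuclideanSpace ℝ (Fin (l + 2)) → ℝ} {ρ a c : ℝ}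
    {x : EuclideanSpace ℝ (Fin (l + 2))} (hx : x ∉ cone l ρ a) : raise f ρ a c x = f x := by
  rw [raise, indicator_of_notMem hx, add_zero]

theorem le_raise {f : EuclideanSpace ℝ (Fin (l + 2)) → ℝ} {ρ a c : ℝ} (hc : 0 ≤ c)
    (x : EuclideanSpace ℝ (Fin (l + 2))) : f x ≤ raise f ρ a c x :=
  le_add_of_nonneg_right (indicator_nonneg (fun _ _ => hc) x)

theorem raise_le {f : EuclideanSpace ℝ (Fin (l + 2)) → ℝ} {ρ a c : ℝ} (hc : 0 ≤ c)
    (x : EuclideanSpace ℝ (Fin (l + 2))) : raise f ρ a c x ≤ f x + c :=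
  add_le_add_right (indicator_le_self' (fun _ _ => hc) x) _

/-- The requirements on the intermediate densities. -/
structure Admissible (f : EuclideanSpace ℝ (Fin (l + 2)) → ℝ) : Prop where
  lowerSemicontinuous : LowerSemicontinuous f
  monotone : IsRadiallyNondecreasing f
  one_add_norm_le : ∀ x, 1 + ‖x‖ ≤ f x
  locallyBounded : ∀ R : ℝ, ∃ M : ℝ, ∀ x, ‖x‖ ≤ R → f x ≤ M

theorem Admissible.pos {f : EuclideanSpace ℝ (Fin (l + 2)) → ℝ} (hf : Admissible f)
    (x : EuclideanSpace ℝ (Fin (l + 2))) : 0 < f x :=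
  (by positivity : 0 < 1 + ‖x‖).trans_le (hf.one_add_norm_le x)

theorem Admissible.add_cone {f : EuclideanSpace ℝ (Fin (l + 2)) → ℝ} (hf : Admissible f)
    {ρ a c : ℝ} (ha : 0 ≤ a) (hc : 0 ≤ c) : Admissible (raise f ρ a c) where
  lowerSemicontinuous := hf.lowerSemicontinuous.add (isOpen_cone.lowerSemicontinuous_indicator hc)
  monotone θ hθ s hs t ht hst := by
    refine add_le_add (hf.monotone θ hθ hs ht hst) ?_
    by_cases hmem : s • θ ∈ cone l ρ a
    · have hs0 : 0 < s := by
        refine lt_of_le_of_ne hs fun h => ?_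
        have := hmem.1
        rw [← h, zero_smul] at this
        simp only [PiLp.zero_apply] at this
        linarith
      have : t • θ ∈ cone l ρ a := by
        have h := smul_mem_cone ha hmem (t := t / s) ((one_le_div hs0).2 hst)
        rwa [smul_smul, div_mul_cancel₀ _ hs0.ne'] at h
      rw [indicator_of_mem hmem, indicator_of_mem this]
    · rw [indicator_of_notMem hmem]
      exact indicator_nonneg (fun _ _ => hc) _
  one_add_norm_le x := (hf.one_add_norm_le x).trans (le_raise hc x)
  locallyBounded R := by
    obtain ⟨M, hM⟩ := hf.locallyBounded R
    exact ⟨M + c, fun x hx => (raise_le hc x).trans (add_le_add_left (hM x hx) c)⟩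

theorem admissible_one_add_norm :
    Admissible (fun x : EuclideanSpace ℝ (Fin (l + 2)) => 1 + ‖x‖) where
  lowerSemicontinuous := (by fun_prop : Continuous fun x : EuclideanSpace ℝ (Fin (l + 2)) =>
    1 + ‖x‖).lowerSemicontinuous
  monotone θ hθ s hs t ht hst := by
    simp only [norm_smul, hθ, Real.norm_eq_abs, mul_one]
    rw [abs_of_nonneg hs, abs_of_nonneg ht]
    linarith
  one_add_norm_le x := le_rfl
  locallyBounded R := ⟨1 + R, fun x hx => by linarith⟩

/-- All these quantities vanish at `ρ = 0` and are continuous. The lateral term carries only `ρ ^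
l`, so it needs `l ≠ 0`: this is where dimension at least three enters. The last bound keeps the
weight before raising below one, leaving volume for `c` to supply. -/
theorem exists_thin_cone (hl : l ≠ 0) (M : ℝ) {a : ℝ} (ha : 0 < a) :
    ∃ ρ : ℝ, 0 < ρ ∧ ρ ≤ 1 ∧
      M * ((2 * (ρ * a)) ^ (l + 1) +
        (l + 1) * (2 * (2 ^ (l + 1) * ((2 * a - a) * (2 * (ρ * (2 * a))) ^ l)))) +
        M * (2 * (ρ * (2 * a))) ^ (l + 1) < 1 / a ∧
      M * (2 * a * (2 * (ρ * (2 * a))) ^ (l + 1)) < 1 / 2 := by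
  have h1 : ∀ᶠ ρ : ℝ in 𝓝 0, M * ((2 * (ρ * a)) ^ (l + 1) +
      (l + 1) * (2 * (2 ^ (l + 1) * ((2 * a - a) * (2 * (ρ * (2 * a))) ^ l)))) +
        M * (2 * (ρ * (2 * a))) ^ (l + 1) < 1 / a := by
    refine ContinuousAt.eventually_lt (by fun_prop) (by fun_prop) ?_
    simpa [hl] using ha
  have h2 : ∀ᶠ ρ : ℝ in 𝓝 0, M * (2 * a * (2 * (ρ * (2 * a))) ^ (l + 1)) < 1 / 2 := by
    refine ContinuousAt.eventually_lt (by fun_prop) (by fun_prop) ?_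
    simp
  have h3 : ∀ᶠ ρ : ℝ in 𝓝[>] 0, ρ ≤ 1 :=
    mem_nhdsWithin_of_mem_nhds (Iic_mem_nhds one_pos)
  obtain ⟨ρ, ⟨⟨h1, h2⟩, h3⟩, h4⟩ := (((h1.and h2).filter_mono nhdsWithin_le_nhds).and h3
    |>.and self_mem_nhdsWithin).exists
  exact ⟨ρ, h4, h3, h1, h2⟩

theorem weightedPerimeter_raise_le {f : EuclideanSpace ℝ (Fin (l + 2)) → ℝ} {ρ a b c M : ℝ}
    (hM : ∀ x ∈ closure (frustum l ρ a b), f x ≤ M) (hM0 : 0 ≤ M) (hc : 0 ≤ c)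
    (hρ : 0 ≤ ρ) (hρ1 : ρ ≤ 1) (ha : 0 ≤ a) (hab : a ≤ b) :
    weightedPerimeter (raise f ρ a c) (frustum l ρ a b) ≤
      ENNReal.ofReal (M * ((2 * (ρ * a)) ^ (l + 1) +
        (l + 1) * (2 * (2 ^ (l + 1) * ((b - a) * (2 * (ρ * b)) ^ l)))) +
        (M + c) * (2 * (ρ * b)) ^ (l + 1)) := by
  have hb : 0 ≤ b := ha.trans hab
  have hba : 0 ≤ b - a := by linarith
  have hsub : essentialBoundary (frustum l ρ a b) ⊆
      lowerFaces l ρ a b ∪ (horizontalFace l ρ b ∩ closure (frustum l ρ a b)) := fun x hx => by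
    have hxf := essentialBoundary_subset_frontier _ hx
    exact (frontier_frustum_subset hxf).imp id fun h => ⟨h, hxf.1⟩
  rw [weightedPerimeter, ENNReal.ofReal_add (by positivity) (by positivity),
    ENNReal.ofReal_mul hM0, ENNReal.ofReal_mul (p := M + c) (by positivity)]
  refine (lintegral_mono_set hsub).trans ((lintegral_union_le _ _ _).trans (add_le_add ?_ ?_))
  · calc _ ≤ ∫⁻ _x in lowerFaces l ρ a b, ENNReal.ofReal M
          ∂(Measure.euclideanHausdorffMeasure (l + 2 - 1)) := by
          refine setLIntegral_mono measurable_const fun x hx => ENNReal.ofReal_le_ofReal ?_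
          rw [raise_of_notMem hx.2]
          exact hM x hx.1
      _ ≤ _ := by
          rw [setLIntegral_const]
          gcongr
          exact hausdorff_lowerFaces_le hρ hρ1 ha hab
  · calc _ ≤ ∫⁻ _x in horizontalFace l ρ b ∩ closure (frustum l ρ a b), ENNReal.ofReal (M + c)
          ∂(Measure.euclideanHausdorffMeasure (l + 2 - 1)) := by
          refine setLIntegral_mono measurable_const fun x hx => ENNReal.ofReal_le_ofReal ?_
          exact (raise_le hc x).trans (add_le_add_left (hM x hx.2) c)
      _ ≤ _ := by
          rw [setLIntegral_const]
          gcongr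
          exact (measure_mono inter_subset_left).trans
            (hausdorff_horizontalFace_le b (by positivity))

/-- A thin cone can be raised so that a frustum of it has weighted volume one and weighted
perimeter of order `1 / a`. -/
theorem Admissible.exists_raise {f : EuclideanSpace ℝ (Fin (l + 2)) → ℝ} (hf : Admissible f)
    (hl : l ≠ 0) {a : ℝ} (ha : 0 < a) :
    ∃ ρ c : ℝ, 0 < ρ ∧ 0 < c ∧
      weightedVolume (raise f ρ a c) (frustum l ρ a (2 * a)) = 1 ∧
      weightedPerimeter (raise f ρ a c) (frustum l ρ a (2 * a)) ≤
        ENNReal.ofReal ((1 + 2 ^ (l + 1)) / a) := by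
  -- The choice of `ρ` depends on `M`, so `M` must bound `f` on the frusta of all slopes `ρ ≤ 1` at
  -- once.
  obtain ⟨M, hM1⟩ : ∃ M : ℝ, ∀ ρ : ℝ, 0 < ρ → ρ ≤ 1 →
      ∀ x ∈ closure (frustum l ρ a (2 * a)), f x ≤ M := by
    set B := {x : EuclideanSpace ℝ (Fin (l + 2)) | ∀ i, |x i| ≤ 2 * a}
    obtain ⟨R, hR⟩ := isBounded_iff_forall_norm_le.1
      (isBounded_of_forall_abs_le (S := B) (2 * a) fun x hx => hx)
    obtain ⟨M, hM⟩ := hf.locallyBounded R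
    refine ⟨M, fun ρ hρ hρ1 x hx => hM x (hR x fun i => ?_)⟩
    obtain ⟨h0, hj⟩ := mem_closure_frustum hx
    have h0' : 0 ≤ x 0 := ha.le.trans h0.1
    refine Fin.cases ?_ (fun j => ?_) i
    · rw [abs_of_nonneg h0']; exact h0.2
    · exact (hj j).trans ((mul_le_of_le_one_left h0' hρ1).trans h0.2)
  obtain ⟨ρ, hρ, hρ1, hP, hV⟩ := exists_thin_cone hl (max M 0) ha
  replace hM1 : ∀ x ∈ closure (frustum l ρ a (2 * a)), f x ≤ max M 0 := fun x hx =>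
    (hM1 ρ hρ hρ1 x hx).trans (le_max_left _ _)
  have hM0 : 0 ≤ max M 0 := le_max_right _ _
  generalize max M 0 = M at hP hV hM1 hM0
  set F := frustum l ρ a (2 * a) with hF
  have hFo : IsOpen F := isOpen_frustum
  have hvol_le := volume_frustum_le (l := l) (b := 2 * a) hρ.le ha.le (by positivity)
  have hle_vol := le_volume_frustum (l := l) (b := 2 * a) hρ.le ha.le (by linarith)
  rw [← hF] at hvol_le hle_vol
  have hvtop : volume F ≠ ∞ := (hvol_le.trans_lt ENNReal.ofReal_lt_top).ne
  have hpos : 0 < (2 * a - a) * (2 * (ρ * a)) ^ (l + 1) := by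
    have : 2 * a - a = a := by ring
    rw [this]; positivity
  have hv0 : volume F ≠ 0 := ((ENNReal.ofReal_pos.2 hpos).trans_le hle_vol).ne'
  set w := ∫⁻ x in F, ENNReal.ofReal (f x) with hw
  have hw1 : w ≤ ENNReal.ofReal (1 / 2) := by
    calc w ≤ ∫⁻ _x in F, ENNReal.ofReal M :=
          setLIntegral_mono measurable_const fun x hx =>
            ENNReal.ofReal_le_ofReal (hM1 x (subset_closure hx))
      _ ≤ ENNReal.ofReal M * ENNReal.ofReal (2 * a * (2 * (ρ * (2 * a))) ^ (l + 1)) := by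
          rw [setLIntegral_const]; gcongr
      _ ≤ _ := by
          rw [← ENNReal.ofReal_mul hM0]
          exact ENNReal.ofReal_le_ofReal hV.le
  have hwlt : w < 1 := hw1.trans_lt (by
    rw [← ENNReal.ofReal_one]
    exact (ENNReal.ofReal_lt_ofReal_iff one_pos).2 (by norm_num))
  have hcd : (1 - w) / volume F ≠ ∞ :=
    ENNReal.div_ne_top (tsub_le_self.trans_lt ENNReal.one_lt_top).ne hv0
  -- The solution of `w + c * volume F = 1`.
  set c := ((1 - w) / volume F).toReal with hc
  have hcof : ENNReal.ofReal c = (1 - w) / volume F := ENNReal.ofReal_toReal hcd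
  have hc0 : 0 < c := by
    refine ENNReal.toReal_pos (ENNReal.div_pos ?_ hvtop).ne' hcd
    exact (tsub_pos_of_lt hwlt).ne'
  refine ⟨ρ, c, hρ, hc0, ?_, ?_⟩
  · calc weightedVolume (raise f ρ a c) F
        = ∫⁻ x in F, (ENNReal.ofReal (f x) + ENNReal.ofReal c) := by
          refine setLIntegral_congr_fun hFo.measurableSet fun x hx => ?_
          rw [raise_of_mem hx.1, ENNReal.ofReal_add (hf.pos x).le hc0.le]
      _ = w + (1 - w) / volume F * volume F := by
          rw [lintegral_add_right _ measurable_const, setLIntegral_const, hcof]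
      _ = 1 := by
          rw [ENNReal.div_mul_cancel hv0 hvtop, add_tsub_cancel_of_le hwlt.le]
  · refine (weightedPerimeter_raise_le hM1 hM0 hc0.le hρ.le hρ1 ha.le (by linarith)).trans
      (ENNReal.ofReal_le_ofReal ?_)
    -- The inscribed box of height `a` gives this bound from `c * volume F ≤ 1`. The top face is
    -- twice as wide as the box in each of `l + 1` directions, so it costs at most `2 ^ (l + 1) /
    -- a`, independently of `ρ`.
    have hcle : c * ((2 * a - a) * (2 * (ρ * a)) ^ (l + 1)) ≤ 1 := by
      refine (ENNReal.ofReal_le_ofReal_iff zero_le_one).1 ?_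
      rw [ENNReal.ofReal_mul hc0.le, hcof, ENNReal.ofReal_one]
      calc _ ≤ (1 - w) / volume F * volume F := by gcongr
        _ = 1 - w := ENNReal.div_mul_cancel hv0 hvtop
        _ ≤ 1 := tsub_le_self
    have hctop : c * (2 * (ρ * (2 * a))) ^ (l + 1) ≤ 2 ^ (l + 1) / a := by
      rw [le_div_iff₀ ha]
      calc c * (2 * (ρ * (2 * a))) ^ (l + 1) * a
          = 2 ^ (l + 1) * (c * ((2 * a - a) * (2 * (ρ * a)) ^ (l + 1))) := by
            rw [show 2 * (ρ * (2 * a)) = 2 * (2 * (ρ * a)) by ring, mul_pow 2 (2 * (ρ * a))]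
            ring
        _ ≤ 2 ^ (l + 1) := mul_le_of_le_one_right (by positivity) hcle
    rw [add_mul M c, add_div]
    linarith

end Stage

/-! ### Iterating the construction. -/

section Limit

variable {l : ℕ}

/-- `g` is an admissible density raised above `f` only in the half-space `x_0 > 2 ^ k`, which has a
set of weighted volume one and weighted perimeter at most `K / 2 ^ k` below height `2 ^ (k + 1)`. -/
structure Improves (K : ℝ) (k : ℕ) (f g : EuclideanSpace ℝ (Fin (l + 2)) → ℝ) : Prop where
  le : ∀ x, f x ≤ g x
  eq_of_le : ∀ x, x 0 ≤ 2 ^ k → g x = f x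
  exists_lt : ∃ x, 0 < x 0 ∧ f x < g x
  exists_set : ∃ E : Set (EuclideanSpace ℝ (Fin (l + 2))), HasLocallyFinitePerimeter E ∧
    MeasurableSet E ∧ (∀ x ∈ closure E, x 0 ≤ 2 ^ (k + 1)) ∧ weightedVolume g E = 1 ∧
    weightedPerimeter g E ≤ ENNReal.ofReal (K / 2 ^ k)

theorem Admissible.exists_improves (hl : l ≠ 0) {f : EuclideanSpace ℝ (Fin (l + 2)) → ℝ}
    (hf : Admissible f) (k : ℕ) :
    ∃ g, Admissible g ∧ Improves (1 + 2 ^ (l + 1)) k f g := by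
  have ha : (0 : ℝ) < 2 ^ k := by positivity
  obtain ⟨ρ, c, hρ, hc, hV, hP⟩ := hf.exists_raise hl ha
  refine ⟨raise f ρ (2 ^ k) c, hf.add_cone ha.le hc.le, le_raise hc.le,
    fun x hx => raise_of_notMem fun h => not_lt.2 hx h.1, ?_,
    frustum l ρ (2 ^ k) (2 * 2 ^ k), ?_, isOpen_frustum.measurableSet, fun x hx => ?_, hV, hP⟩
  · have hx : EuclideanSpace.single (0 : Fin (l + 2)) (2 * 2 ^ k : ℝ) ∈ cone l ρ (2 ^ k) := by
      refine ⟨?_, fun j => ?_⟩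
      · simp only [PiLp.single_apply, if_true]
        linarith
      · simp [hρ]
    refine ⟨_, ha.trans hx.1, ?_⟩
    rw [raise_of_mem hx]
    exact lt_add_of_pos_right _ hc
  · exact hasLocallyFinitePerimeter_of_convex isOpen_frustum.measurableSet convex_frustum
      (isBounded_frustum hρ.le ha.le)
  · rw [pow_succ']
    exact (mem_closure_frustum hx).1.2

theorem exists_improving_sequence (hl : l ≠ 0) :
    ∃ F : ℕ → EuclideanSpace ℝ (Fin (l + 2)) → ℝ, (F 0 = fun x => 1 + ‖x‖) ∧
      (∀ k, Admissible (F k)) ∧ ∀ k, Improves (1 + 2 ^ (l + 1)) k (F k) (F (k + 1)) := by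
  have h : ∀ (f : {f : EuclideanSpace ℝ (Fin (l + 2)) → ℝ // Admissible f}) (k : ℕ),
      ∃ g : {f : EuclideanSpace ℝ (Fin (l + 2)) → ℝ // Admissible f},
        Improves (1 + 2 ^ (l + 1)) k f.1 g.1 := fun f k => by
    obtain ⟨g, hg, hi⟩ := f.2.exists_improves hl k
    exact ⟨⟨g, hg⟩, hi⟩
  choose next hnext using h
  let F : ℕ → {f : EuclideanSpace ℝ (Fin (l + 2)) → ℝ // Admissible f} :=
    fun k => Nat.rec ⟨_, admissible_one_add_norm⟩ (fun k f => next f k) k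
  exact ⟨fun k => (F k).1, rfl, fun k => (F k).2, fun k => hnext (F k) k⟩

/-- Stages from `k` on change nothing where `x_0 ≤ 2 ^ k`, so each point sees finitely many
raisings, and stage `⌈x 0⌉₊` is already final at `x`. -/
theorem exists_density_limit (hl : l ≠ 0) :
    ∃ (K : ℝ) (F : ℕ → EuclideanSpace ℝ (Fin (l + 2)) → ℝ)
      (f : EuclideanSpace ℝ (Fin (l + 2)) → ℝ), (F 0 = fun x => 1 + ‖x‖) ∧
      (∀ k, Admissible (F k)) ∧ (∀ k, Improves K k (F k) (F (k + 1))) ∧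
      (∀ k x, x 0 ≤ 2 ^ k → f x = F k x) ∧ ∀ k x, F k x ≤ f x := by
  obtain ⟨F, h0, hF, hi⟩ := exists_improving_sequence hl
  have heq : ∀ k j x, k ≤ j → x 0 ≤ 2 ^ k → F j x = F k x := by
    intro k j x hkj hx
    induction j, hkj using Nat.le_induction with
    | base => rfl
    | succ j hkj ih =>
      rw [← ih]
      exact (hi j).eq_of_le x (hx.trans (pow_le_pow_right₀ one_le_two hkj))
  have hmono : ∀ x, Monotone fun k => F k x := fun x => monotone_nat_of_le_succ fun k => (hi k).le x
  have hN : ∀ x : EuclideanSpace ℝ (Fin (l + 2)), x 0 ≤ 2 ^ ⌈x 0⌉₊ := fun x => by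
    have h : ((⌈x 0⌉₊ : ℕ) : ℝ) ≤ ((2 ^ ⌈x 0⌉₊ : ℕ) : ℝ) :=
      Nat.cast_le.2 (Nat.lt_two_pow_self (n := ⌈x 0⌉₊)).le
    rw [Nat.cast_pow, Nat.cast_ofNat] at h
    exact (Nat.le_ceil _).trans h
  have hf : ∀ k x, x 0 ≤ 2 ^ k → F ⌈x 0⌉₊ x = F k x := fun k x hx => by
    rcases le_total k ⌈x 0⌉₊ with h | h
    · exact heq k _ x h hx
    · exact (heq _ _ x h (hN x)).symm
  refine ⟨_, F, fun x => F ⌈x 0⌉₊ x, h0, hF, hi, hf, fun k x => ?_⟩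
  dsimp only
  rw [hf (max k ⌈x 0⌉₊) x ((hN x).trans (pow_le_pow_right₀ one_le_two (le_max_right _ _)))]
  exact hmono x (le_max_left _ _)

end Limit

/-! ### The resulting density has no isoperimetric set of volume one. -/

/-- The main construction, with the dimension written as `l + 2`. -/
theorem exists_density_without_isoperimetric_set {l : ℕ} (hl : l ≠ 0) :
    ∃ f : EuclideanSpace ℝ (Fin (l + 2)) → ℝ,
      IsDensity f ∧ IsRadiallyNondecreasing f ∧ IsDiverging f ∧ ¬ IsRadial f ∧
      isoperimetricProfile f 1 = 0 ∧
      ¬ ∃ E : Set (EuclideanSpace ℝ (Fin (l + 2))),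
        IsIsoperimetricSet f E ∧ weightedVolume f E = 1 := by
  obtain ⟨K, F, f, h0, hF, hi, hfF, hFf⟩ := exists_density_limit hl
  have hlow : ∀ x, 1 + ‖x‖ ≤ f x := fun x => ((hF 0).one_add_norm_le x).trans (hFf 0 x)
  have hexists : ∀ r : ℝ, ∃ k : ℕ, r < 2 ^ k := fun r => pow_unbounded_of_one_lt r one_lt_two
  have hdens : IsDensity f := by
    refine ⟨fun x => (by positivity : 0 < 1 + ‖x‖).trans_le (hlow x), fun x y hy => ?_⟩
    obtain ⟨k, hk⟩ := hexists (x 0)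
    change y < f x at hy
    rw [hfF k x hk.le] at hy
    -- On the open half-space `x_0 < 2 ^ k` the density coincides with a single stage, so lower
    -- semicontinuity is inherited locally.
    have hev : ∀ᶠ z : EuclideanSpace ℝ (Fin (l + 2)) in 𝓝 x, z 0 < 2 ^ k :=
      ContinuousAt.eventually_lt (by fun_prop) (by fun_prop) hk
    filter_upwards [(hF k).lowerSemicontinuous x y hy, hev] with z hz hzk
    change y < f z
    rwa [hfF k z hzk.le]
  have hmono : IsRadiallyNondecreasing f := by
    intro θ hθ s hs t ht hst
    obtain ⟨k, hk⟩ := hexists (max ((s • θ) 0) ((t • θ) 0))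
    dsimp only
    rw [hfF k _ ((le_max_left _ _).trans hk.le), hfF k _ ((le_max_right _ _).trans hk.le)]
    exact (hF k).monotone θ hθ hs ht hst
  have hprof : isoperimetricProfile f 1 = 0 := by
    have hle : ∀ k : ℕ, isoperimetricProfile f 1 ≤ ENNReal.ofReal (K / 2 ^ k) := by
      intro k
      obtain ⟨E, hE, hEm, hEc, hV, hP⟩ := (hi k).exists_set
      -- Agreement is needed on the closure, since the perimeter is integrated over the essential
      -- boundary, a subset of the frontier.
      have hagree : ∀ x ∈ closure E, f x = F (k + 1) x := fun x hx => hfF _ x (hEc x hx)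
      have hV' : weightedVolume f E = 1 := by
        rw [← hV]
        exact setLIntegral_congr_fun hEm fun x hx => by rw [hagree x (subset_closure hx)]
      have hinf : isoperimetricProfile f 1 ≤ weightedPerimeter f E := sInf_le ⟨E, hE, hV', rfl⟩
      refine hinf.trans (le_trans ?_ hP)
      refine setLIntegral_mono (hF _).lowerSemicontinuous.measurable.ennreal_ofReal
        fun x hx => ?_
      rw [hagree x (essentialBoundary_subset_frontier E hx).1]
    refine le_antisymm (ge_of_tendsto' (x := atTop) ?_ hle) bot_le
    have : Tendsto (fun k : ℕ => K / 2 ^ k) atTop (𝓝 0) :=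
      tendsto_const_nhds.div_atTop (tendsto_pow_atTop_atTop_of_one_lt one_lt_two)
    simpa using ENNReal.tendsto_ofReal this
  refine ⟨f, hdens, hmono, ?_, ?_, hprof, ?_⟩
  · refine tendsto_atTop_mono (fun x => ?_) (tendsto_norm_cocompact_atTop)
    linarith [hlow x]
  · intro hrad
    obtain ⟨x, hx0, hx⟩ := (hi 0).exists_lt
    -- The opposite point has negative first coordinate, where nothing was ever raised.
    have h1 : f (-x) = 1 + ‖x‖ := by
      rw [hfF 0 (-x) (by simp only [PiLp.neg_apply, pow_zero]; linarith), h0]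
      simp
    have h2 := hrad x (-x) (norm_neg x).symm
    have h3 := hFf (0 + 1) x
    rw [h0] at hx
    dsimp only at hx
    linarith
  · rintro ⟨E, ⟨hE, hper⟩, hV⟩
    have htot : ∫⁻ x, ENNReal.ofReal (f x) = ∞ := by
      rw [eq_top_iff]
      calc ∞ = ∫⁻ _x : EuclideanSpace ℝ (Fin (l + 2)), 1 := by
            rw [lintegral_one, measure_univ_of_isAddLeftInvariant]
        _ ≤ _ := lintegral_mono fun x => by
            rw [← ENNReal.ofReal_one]
            exact ENNReal.ofReal_le_ofReal (by linarith [hlow x, norm_nonneg x])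
    refine weightedPerimeter_ne_zero hdens htot hE.nullMeasurableSet ?_ ?_ ?_
    · rw [hV]; exact one_ne_zero
    · rw [hV]; exact ENNReal.one_ne_top
    · rw [hper, hV, hprof]

end IsoDensity

theorem mainTheorem11 (n : ℕ) (hn : 3 ≤ n) :
    ∃ f : EuclideanSpace ℝ (Fin n) → ℝ,
      IsoDensity.IsDensity f ∧
      IsoDensity.IsRadiallyNondecreasing f ∧
      IsoDensity.IsDiverging f ∧
      ¬ IsoDensity.IsRadial f ∧
      IsoDensity.isoperimetricProfile f 1 = 0 ∧
      ¬ ∃ E : Set (EuclideanSpace ℝ (Fin n)),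
        IsoDensity.IsIsoperimetricSet f E ∧ IsoDensity.weightedVolume f E = 1 := by
  obtain ⟨l, rfl⟩ : ∃ l, n = l + 2 := ⟨n - 2, by omega⟩
  exact IsoDensity.exists_density_without_isoperimetric_set (by omega)
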